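/- \textbf{${\cal L}_c{\cal S}$-Coherence.} A \emph{symmetric monoidal monad} (with $\psi^L,\psi^R$ primitive) is a symmetric monoidal category $\langle{\cal A},\otimes,I,a,l,r,c\rangle$ with a monad $\langle T,\eta,\mu\rangle$ on ${\cal A}$ and natural transformations $\psi^L_{A,B}\colon TA\otimes B\to T(A\otimes B)$, $\psi^R_{A,B}\colon A\otimes TB\to T(A\otimes B)$ such that $$Ta_{A,B,C}\circ\psi^L_{A\otimes B,C}\circ(\psi^L_{A,B}\otimes 1_C)=\psi^L_{A,B\otimes C}\circ a_{TA,B,C},\qquad Tr_A\circ\psi^L_{A,I}=r_{TA},$$ $$Ta_{A,B,C}\circ\psi^R_{A\otimes B,C}=\psi^R_{A,B\otimes C}\circ(1_A\otimes\psi^R_{B,C})\circ a_{A,B,TC},\qquad Tl_A\circ\psi^R_{I,A}=l_{TA},$$ $$Ta_{A,B,C}\circ\psi^L_{A\otimes B,C}\circ(\psi^R_{A,B}\otimes 1_C)=\psi^R_{A,B\otimes C}\circ(1_A\otimes\psi^L_{B,C})\circ a_{A,TB,C},$$ $$\psi^L_{A,B}\circ(\eta_A\otimes 1_B)=\eta_{A\otimes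 B},\qquad \psi^L_{A,B}\circ(\mu_A\otimes 1_B)=\mu_{A\otimes B}\circ T\psi^L_{A,B}\circ\psi^L_{TA,B},$$ $$\psi^R_{A,B}\circ(1_A\otimes\eta_B)=\eta_{A\otimes B},\qquad \psi^R_{A,B}\circ(1_A\otimes\mu_B)=\mu_{A\otimes B}\circ T\psi^R_{A,B}\circ\psi^R_{A,TB},$$ $$\mu_{A\otimes B}\circ T\psi^L_{A,B}\circ\psi^R_{TA,B}=\mu_{A\otimes B}\circ T\psi^R_{A,B}\circ\psi^L_{A,TB},\qquad Tc_{A,B}\circ\psi^L_{A,B}=\psi^R_{B,A}\circ c_{TA,B}.$$ Let $P$ be an arbitrary set and let ${\cal L}_c{\cal S}$ be the category of the symmetric monoidal monad freely generated by $P$: its objects are the formulas built from the letters in $P$ and $I$ with $\otimes$ and $T$, and its arrows are the arrow terms built from $1,a,a^{-1},l,l^{-1},r,r^{-1},c,\psi^L,\psi^R,\eta,\mu$ with $\circ$, $\otimes$ and $T$, modulo the congruence generated by the equations of symmetric monoidal monads. Let $\mathit{Fun}$ be the category whose objects are the finite ordinals and whose arrows are arbitrary functions between them. Define a functor $G\colon{\cal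 L}_c{\cal S}\to\mathit{Fun}$ as follows. $GA$ is the number of occurrences of letters in $A$ plus the number of occurrences of $T$ in $A$, these occurrences being numbered $0,1,2,\ldots$ from right to left. $G$ of $1,a,a^{-1},l,l^{-1},r,r^{-1}$ and $\psi^L$ is the identity function. $G\eta_A\colon GA\to GA+1$ is the inclusion $i\mapsto i$; $G\mu_A\colon GA+2\to GA+1$ sends $GA+1$ to $GA$ and every $i\le GA$ to $i$. $G\psi^R_{A,B}$ is the bijection that sends the outermost $T$ of $TB$ to the outermost $T$ of $T(A\otimes B)$ and every occurrence in $A$, respectively in $B$, to the same occurrence in $A$, respectively in $B$. $Gc_{A,B}$ is the crossing bijection, which sends every occurrence in $A$, respectively in $B$, to the same occurrence in $A$, respectively in $B$. Finally, $G(f\otimes g)$ puts $Gf$ and $Gg$ side by side, $G(Tf)$ extends $Gf$ by sending the outermost $T$ to the outermost $T$, and $G(g\circ f)=Gg\circ Gf$. Then the functor $G$ is faithful. -/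

import Mathlib

open CategoryTheory MonoidalCategory

universe u v

/-- A symmetric monoidal monad, with the local strengths `ψL` and `ψR` primitive: a monad
`(T, η, μ)` on a symmetric monoidal category whose endofunctor is locally linear and which is both
left strong and right strong, the two resulting maps `TA ⊗ TB ⟶ T (A ⊗ B)` being equal. -/
structure SymmetricMonoidalMonad (C : Type u) [Category.{v} C] [MonoidalCategory C]
    [SymmetricCategory C] extends Monad C where
  ψL (A B : C) : obj A ⊗ B ⟶ obj (A ⊗ B)
  ψR (A B : C) : A ⊗ obj B ⟶ obj (A ⊗ B)
  ψL_natural {A A' B B' : C} (f : A ⟶ A') (g : B ⟶ B') :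
    (map f ⊗ₘ g) ≫ ψL A' B' = ψL A B ≫ map (f ⊗ₘ g)
  ψR_natural {A A' B B' : C} (f : A ⟶ A') (g : B ⟶ B') :
    (f ⊗ₘ map g) ≫ ψR A' B' = ψR A B ≫ map (f ⊗ₘ g)
  ψL_a (A B D : C) :
    (ψL A B ⊗ₘ 𝟙 D) ≫ ψL (A ⊗ B) D ≫ map (α_ A B D).hom =
      (α_ (obj A) B D).hom ≫ ψL A (B ⊗ D)
  ψL_r (A : C) : ψL A (𝟙_ C) ≫ map (ρ_ A).hom = (ρ_ (obj A)).hom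
  ψR_a (A B D : C) :
    ψR (A ⊗ B) D ≫ map (α_ A B D).hom =
      (α_ A B (obj D)).hom ≫ (𝟙 A ⊗ₘ ψR B D) ≫ ψR A (B ⊗ D)
  ψR_l (A : C) : ψR (𝟙_ C) A ≫ map (λ_ A).hom = (λ_ (obj A)).hom
  ψLψR_a (A B D : C) :
    (ψR A B ⊗ₘ 𝟙 D) ≫ ψL (A ⊗ B) D ≫ map (α_ A B D).hom =
      (α_ A (obj B) D).hom ≫ (𝟙 A ⊗ₘ ψL B D) ≫ ψR A (B ⊗ D)
  ψL_η (A B : C) : (η.app A ⊗ₘ 𝟙 B) ≫ ψL A B = η.app (A ⊗ B)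
  ψL_μ (A B : C) :
    (μ.app A ⊗ₘ 𝟙 B) ≫ ψL A B = ψL (obj A) B ≫ map (ψL A B) ≫ μ.app (A ⊗ B)
  ψR_η (A B : C) : (𝟙 A ⊗ₘ η.app B) ≫ ψR A B = η.app (A ⊗ B)
  ψR_μ (A B : C) :
    (𝟙 A ⊗ₘ μ.app B) ≫ ψR A B = ψR A (obj B) ≫ map (ψR A B) ≫ μ.app (A ⊗ B)
  ψLψR_μ (A B : C) :
    ψR (obj A) B ≫ map (ψL A B) ≫ μ.app (A ⊗ B) =
      ψL A (obj B) ≫ map (ψR A B) ≫ μ.app (A ⊗ B)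
  ψLψR_c (A B : C) : ψL A B ≫ map (β_ A B).hom = (β_ (obj A) B).hom ≫ ψR B A

/-- Objects of the symmetric monoidal monad freely generated by the set `P` of objects:
formulas built from the letters in `P` and the constant `I` with `⊗` and `T`. -/
inductive LcS (P : Type u) : Type u
  | letter (p : P) : LcS P
  | I : LcS P
  | tensor (A B : LcS P) : LcS P
  | T (A : LcS P) : LcS P

namespace LcS

variable {P : Type u}

/-- Arrow terms. Composition is written in diagrammatic order. -/
inductive Term : LcS P → LcS P → Type u
  | id (A : LcS P) : Term A A
  | comp {A B C : LcS P} (f : Term A B) (g : Term B C) : Term A C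
  | tensor {A A' B B' : LcS P} (f : Term A A') (g : Term B B') : Term (A.tensor B) (A'.tensor B')
  | map {A B : LcS P} (f : Term A B) : Term A.T B.T
  | a (A B C : LcS P) : Term ((A.tensor B).tensor C) (A.tensor (B.tensor C))
  | aInv (A B C : LcS P) : Term (A.tensor (B.tensor C)) ((A.tensor B).tensor C)
  | l (A : LcS P) : Term (I.tensor A) A
  | lInv (A : LcS P) : Term A (I.tensor A)
  | r (A : LcS P) : Term (A.tensor I) A
  | rInv (A : LcS P) : Term A (A.tensor I)
  | c (A B : LcS P) : Term (A.tensor B) (B.tensor A)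
  | ψL (A B : LcS P) : Term (A.T.tensor B) (A.tensor B).T
  | ψR (A B : LcS P) : Term (A.tensor B.T) (A.tensor B).T
  | η (A : LcS P) : Term A A.T
  | μ (A : LcS P) : Term A.T.T A.T

/-- Equality of arrow terms: the least congruence containing the equations of symmetric monoidal
monads. -/
inductive Eqv : ∀ {A B : LcS P}, Term A B → Term A B → Prop
  -- congruence
  | refl {A B : LcS P} (f : Term A B) : Eqv f f
  | symm {A B : LcS P} {f g : Term A B} : Eqv f g → Eqv g f
  | trans {A B : LcS P} {f g h : Term A B} : Eqv f g → Eqv g h → Eqv f h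
  | comp {A B C : LcS P} {f f' : Term A B} {g g' : Term B C} :
      Eqv f f' → Eqv g g' → Eqv (f.comp g) (f'.comp g')
  | tensor {A A' B B' : LcS P} {f f' : Term A A'} {g g' : Term B B'} :
      Eqv f f' → Eqv g g' → Eqv (f.tensor g) (f'.tensor g')
  | map {A B : LcS P} {f f' : Term A B} : Eqv f f' → Eqv f.map f'.map
  -- category
  | id_comp {A B : LcS P} (f : Term A B) : Eqv ((Term.id A).comp f) f
  | comp_id {A B : LcS P} (f : Term A B) : Eqv (f.comp (Term.id B)) f
  | assoc {A B C D : LcS P} (f : Term A B) (g : Term B C) (h : Term C D) :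
      Eqv ((f.comp g).comp h) (f.comp (g.comp h))
  -- `⊗` is a bifunctor, `T` is a functor
  | tensor_id (A B : LcS P) : Eqv ((Term.id A).tensor (Term.id B)) (Term.id (A.tensor B))
  | tensor_comp {A A' A'' B B' B'' : LcS P} (f : Term A A') (f' : Term A' A'') (g : Term B B')
      (g' : Term B' B'') :
      Eqv ((f.tensor g).comp (f'.tensor g')) ((f.comp f').tensor (g.comp g'))
  | map_id (A : LcS P) : Eqv (Term.id A).map (Term.id A.T)
  | map_comp {A B C : LcS P} (f : Term A B) (g : Term B C) :
      Eqv (f.comp g).map (f.map.comp g.map)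
  -- `a`, `l`, `r` are natural isomorphisms satisfying the pentagon and the triangle equations
  | a_aInv (A B C : LcS P) : Eqv ((Term.a A B C).comp (Term.aInv A B C)) (Term.id _)
  | aInv_a (A B C : LcS P) : Eqv ((Term.aInv A B C).comp (Term.a A B C)) (Term.id _)
  | a_natural {A A' B B' C C' : LcS P} (f : Term A A') (g : Term B B') (h : Term C C') :
      Eqv (((f.tensor g).tensor h).comp (Term.a A' B' C'))
        ((Term.a A B C).comp (f.tensor (g.tensor h)))
  | l_lInv (A : LcS P) : Eqv ((Term.l A).comp (Term.lInv A)) (Term.id _)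
  | lInv_l (A : LcS P) : Eqv ((Term.lInv A).comp (Term.l A)) (Term.id _)
  | l_natural {A B : LcS P} (f : Term A B) :
      Eqv (((Term.id I).tensor f).comp (Term.l B)) ((Term.l A).comp f)
  | r_rInv (A : LcS P) : Eqv ((Term.r A).comp (Term.rInv A)) (Term.id _)
  | rInv_r (A : LcS P) : Eqv ((Term.rInv A).comp (Term.r A)) (Term.id _)
  | r_natural {A B : LcS P} (f : Term A B) :
      Eqv ((f.tensor (Term.id I)).comp (Term.r B)) ((Term.r A).comp f)
  | pentagon (A B C D : LcS P) :
      Eqv (((Term.a A B C).tensor (Term.id D)).comp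
          ((Term.a A (B.tensor C) D).comp ((Term.id A).tensor (Term.a B C D))))
        ((Term.a (A.tensor B) C D).comp (Term.a A B (C.tensor D)))
  | triangle (A B : LcS P) :
      Eqv ((Term.a A I B).comp ((Term.id A).tensor (Term.l B))) ((Term.r A).tensor (Term.id B))
  -- `c` is a symmetry
  | c_natural {A A' B B' : LcS P} (f : Term A A') (g : Term B B') :
      Eqv ((f.tensor g).comp (Term.c A' B')) ((Term.c A B).comp (g.tensor f))
  | c_c (A B : LcS P) : Eqv ((Term.c A B).comp (Term.c B A)) (Term.id _)
  | hexagon (A B C : LcS P) :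
      Eqv ((Term.a A B C).comp ((Term.c A (B.tensor C)).comp (Term.a B C A)))
        (((Term.c A B).tensor (Term.id C)).comp
          ((Term.a B A C).comp ((Term.id B).tensor (Term.c A C))))
  -- `(T, η, μ)` is a monad
  | η_natural {A B : LcS P} (f : Term A B) : Eqv (f.comp (Term.η B)) ((Term.η A).comp f.map)
  | μ_natural {A B : LcS P} (f : Term A B) :
      Eqv (f.map.map.comp (Term.μ B)) ((Term.μ A).comp f.map)
  | μ_assoc (A : LcS P) :
      Eqv ((Term.μ A).map.comp (Term.μ A)) ((Term.μ A.T).comp (Term.μ A))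
  | η_μ (A : LcS P) : Eqv ((Term.η A.T).comp (Term.μ A)) (Term.id _)
  | map_η_μ (A : LcS P) : Eqv ((Term.η A).map.comp (Term.μ A)) (Term.id _)
  -- `T` is a locally linear endofunctor
  | ψL_natural {A A' B B' : LcS P} (f : Term A A') (g : Term B B') :
      Eqv ((f.map.tensor g).comp (Term.ψL A' B')) ((Term.ψL A B).comp (f.tensor g).map)
  | ψR_natural {A A' B B' : LcS P} (f : Term A A') (g : Term B B') :
      Eqv ((f.tensor g.map).comp (Term.ψR A' B')) ((Term.ψR A B).comp (f.tensor g).map)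
  | ψL_a (A B C : LcS P) :
      Eqv (((Term.ψL A B).tensor (Term.id C)).comp
          ((Term.ψL (A.tensor B) C).comp (Term.a A B C).map))
        ((Term.a A.T B C).comp (Term.ψL A (B.tensor C)))
  | ψL_r (A : LcS P) : Eqv ((Term.ψL A I).comp (Term.r A).map) (Term.r A.T)
  | ψR_a (A B C : LcS P) :
      Eqv ((Term.ψR (A.tensor B) C).comp (Term.a A B C).map)
        ((Term.a A B C.T).comp
          (((Term.id A).tensor (Term.ψR B C)).comp (Term.ψR A (B.tensor C))))
  | ψR_l (A : LcS P) : Eqv ((Term.ψR I A).comp (Term.l A).map) (Term.l A.T)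
  | ψLψR_a (A B C : LcS P) :
      Eqv (((Term.ψR A B).tensor (Term.id C)).comp
          ((Term.ψL (A.tensor B) C).comp (Term.a A B C).map))
        ((Term.a A B.T C).comp
          (((Term.id A).tensor (Term.ψL B C)).comp (Term.ψR A (B.tensor C))))
  | ψLψR_c (A B : LcS P) :
      Eqv ((Term.ψL A B).comp (Term.c A B).map) ((Term.c A.T B).comp (Term.ψR B A))
  -- compatibility of the strengths with `η` and `μ`
  | ψL_η (A B : LcS P) :
      Eqv (((Term.η A).tensor (Term.id B)).comp (Term.ψL A B)) (Term.η (A.tensor B))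
  | ψL_μ (A B : LcS P) :
      Eqv (((Term.μ A).tensor (Term.id B)).comp (Term.ψL A B))
        ((Term.ψL A.T B).comp ((Term.ψL A B).map.comp (Term.μ (A.tensor B))))
  | ψR_η (A B : LcS P) :
      Eqv (((Term.id A).tensor (Term.η B)).comp (Term.ψR A B)) (Term.η (A.tensor B))
  | ψR_μ (A B : LcS P) :
      Eqv (((Term.id A).tensor (Term.μ B)).comp (Term.ψR A B))
        ((Term.ψR A B.T).comp ((Term.ψR A B).map.comp (Term.μ (A.tensor B))))
  | ψLψR_μ (A B : LcS P) :
      Eqv ((Term.ψR A.T B).comp ((Term.ψL A B).map.comp (Term.μ (A.tensor B))))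
        ((Term.ψL A B.T).comp ((Term.ψR A B).map.comp (Term.μ (A.tensor B))))

instance setoid (A B : LcS P) : Setoid (Term A B) :=
  ⟨Eqv, ⟨Eqv.refl, Eqv.symm, Eqv.trans⟩⟩

/-- The category of the free symmetric monoidal monad: arrows are arrow terms modulo the
equations of symmetric monoidal monads. -/
instance : Category.{u} (LcS P) where
  Hom A B := Quotient (setoid A B)
  id A := ⟦Term.id A⟧
  comp := Quotient.map₂ Term.comp (fun _ _ hf _ _ hg => Eqv.comp hf hg)
  id_comp := by rintro A B ⟨f⟩; exact Quotient.sound (Eqv.id_comp f)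
  comp_id := by rintro A B ⟨f⟩; exact Quotient.sound (Eqv.comp_id f)
  assoc := by rintro A B C D ⟨f⟩ ⟨g⟩ ⟨h⟩; exact Quotient.sound (Eqv.assoc f g h)

/-- The arrow denoted by an arrow term. -/
abbrev mk {A B : LcS P} (f : Term A B) : A ⟶ B := Quotient.mk (setoid A B) f

/-- The action of `⊗` on arrows. -/
def tensorMap {A A' B B' : LcS P} : (A ⟶ A') → (B ⟶ B') → (A.tensor B ⟶ A'.tensor B') :=
  Quotient.map₂ Term.tensor (fun _ _ hf _ _ hg => Eqv.tensor hf hg)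

instance : MonoidalCategoryStruct (LcS P) where
  tensorObj := tensor
  tensorUnit := I
  tensorHom f g := tensorMap f g
  whiskerLeft A _ _ f := tensorMap (𝟙 A) f
  whiskerRight f B := tensorMap f (𝟙 B)
  associator A B C :=
    ⟨mk (Term.a A B C), mk (Term.aInv A B C), Quotient.sound (Eqv.a_aInv A B C),
      Quotient.sound (Eqv.aInv_a A B C)⟩
  leftUnitor A :=
    ⟨mk (Term.l A), mk (Term.lInv A), Quotient.sound (Eqv.l_lInv A), Quotient.sound (Eqv.lInv_l A)⟩
  rightUnitor A :=
    ⟨mk (Term.r A), mk (Term.rInv A), Quotient.sound (Eqv.r_rInv A), Quotient.sound (Eqv.rInv_r A)⟩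

instance : MonoidalCategory (LcS P) :=
  MonoidalCategory.ofTensorHom
    (id_tensorHom_id := fun A B => Quotient.sound (Eqv.tensor_id A B))
    (id_tensorHom := fun _ _ _ _ => rfl)
    (tensorHom_id := fun _ _ => rfl)
    (tensorHom_comp_tensorHom := by
      rintro A A' A'' B B' B'' ⟨f⟩ ⟨g⟩ ⟨f'⟩ ⟨g'⟩
      exact Quotient.sound (Eqv.tensor_comp f f' g g'))
    (associator_naturality := by
      rintro A B C A' B' C' ⟨f⟩ ⟨g⟩ ⟨h⟩
      exact Quotient.sound (Eqv.a_natural f g h))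
    (leftUnitor_naturality := by rintro A B ⟨f⟩; exact Quotient.sound (Eqv.l_natural f))
    (rightUnitor_naturality := by rintro A B ⟨f⟩; exact Quotient.sound (Eqv.r_natural f))
    (pentagon := fun A B C D => Quotient.sound (Eqv.pentagon A B C D))
    (triangle := fun A B => Quotient.sound (Eqv.triangle A B))

/-- The symmetry isomorphism. -/
def sym (A B : LcS P) : A ⊗ B ≅ B ⊗ A :=
  ⟨mk (Term.c A B), mk (Term.c B A), Quotient.sound (Eqv.c_c A B), Quotient.sound (Eqv.c_c B A)⟩

theorem sym_hexagon (A B C : LcS P) :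
    (α_ A B C).hom ≫ (sym A (B ⊗ C)).hom ≫ (α_ B C A).hom =
      ((sym A B).hom ▷ C) ≫ (α_ B A C).hom ≫ (B ◁ (sym A C).hom) :=
  Quotient.sound (Eqv.hexagon A B C)

instance : SymmetricCategory (LcS P) where
  braiding := sym
  braiding_naturality_right A _ _ := by
    rintro ⟨f⟩; exact Quotient.sound (Eqv.c_natural (Term.id A) f)
  braiding_naturality_left := by
    rintro A B ⟨f⟩ C; exact Quotient.sound (Eqv.c_natural f (Term.id C))
  hexagon_forward := sym_hexagon
  hexagon_reverse A B C := by
    have h := sym_hexagon C A B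
    have e : ∀ X Y : LcS P, (sym X Y).hom = (sym Y X).inv := fun _ _ => rfl
    rw [e, e C A, e C B] at h
    rw [← cancel_epi ((α_ C A B).hom ≫ (sym (A ⊗ B) C).inv ≫ (α_ A B C).hom)]
    conv_rhs => rw [h]
    simp
  symmetry A B := Quotient.sound (Eqv.c_c A B)

/-- The free symmetric monoidal monad on `P`. -/
def monad (P : Type u) : SymmetricMonoidalMonad (LcS P) where
  obj := T
  map := Quotient.map Term.map (fun _ _ h => Eqv.map h)
  map_id A := Quotient.sound (Eqv.map_id A)
  map_comp := by rintro A B C ⟨f⟩ ⟨g⟩; exact Quotient.sound (Eqv.map_comp f g)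
  η := { app := fun A => mk (Term.η A)
         naturality := by rintro A B ⟨f⟩; exact Quotient.sound (Eqv.η_natural f) }
  μ := { app := fun A => mk (Term.μ A)
         naturality := by rintro A B ⟨f⟩; exact Quotient.sound (Eqv.μ_natural f) }
  assoc A := Quotient.sound (Eqv.μ_assoc A)
  left_unit A := Quotient.sound (Eqv.η_μ A)
  right_unit A := Quotient.sound (Eqv.map_η_μ A)
  ψL A B := mk (Term.ψL A B)
  ψR A B := mk (Term.ψR A B)
  ψL_natural := by rintro A A' B B' ⟨f⟩ ⟨g⟩; exact Quotient.sound (Eqv.ψL_natural f g)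
  ψR_natural := by rintro A A' B B' ⟨f⟩ ⟨g⟩; exact Quotient.sound (Eqv.ψR_natural f g)
  ψL_a A B C := Quotient.sound (Eqv.ψL_a A B C)
  ψL_r A := Quotient.sound (Eqv.ψL_r A)
  ψR_a A B C := Quotient.sound (Eqv.ψR_a A B C)
  ψR_l A := Quotient.sound (Eqv.ψR_l A)
  ψLψR_a A B C := Quotient.sound (Eqv.ψLψR_a A B C)
  ψL_η A B := Quotient.sound (Eqv.ψL_η A B)
  ψL_μ A B := Quotient.sound (Eqv.ψL_μ A B)
  ψR_η A B := Quotient.sound (Eqv.ψR_η A B)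
  ψR_μ A B := Quotient.sound (Eqv.ψR_μ A B)
  ψLψR_μ A B := Quotient.sound (Eqv.ψLψR_μ A B)
  ψLψR_c A B := Quotient.sound (Eqv.ψLψR_c A B)

/-- The number of occurrences of letters in `A` plus the number of occurrences of `T` in `A`.
The occurrences in `A` are numbered from right to left, starting from `0`, so that in `A ⊗ B`
those of `B` come first, and the outermost `T` of `T A` comes last. -/
def size : LcS P → ℕ
  | letter _ => 1
  | I => 0
  | tensor A B => size B + size A
  | T A => size A + 1

/-- The function between finite ordinals assigned to an arrow term. -/
def gmap : ∀ {A B : LcS P}, Term A B → Fin (size A) → Fin (size B)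
  | _, _, .id _ => fun x => x
  | _, _, .comp f g => fun x => gmap g (gmap f x)
  | _, _, @Term.tensor _ _ A' _ B' f g =>
      Fin.addCases (fun j => Fin.castAdd (size A') (gmap g j))
        (fun i => Fin.natAdd (size B') (gmap f i))
  | _, _, @Term.map _ _ B f =>
      Fin.lastCases (Fin.last (size B)) (fun i => Fin.castSucc (gmap f i))
  | _, _, .a A B C => Fin.cast (Nat.add_assoc (size C) (size B) (size A)).symm
  | _, _, .aInv A B C => Fin.cast (Nat.add_assoc (size C) (size B) (size A))
  | _, _, .l A => Fin.cast (Nat.add_zero (size A))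
  | _, _, .lInv A => Fin.cast (Nat.add_zero (size A)).symm
  | _, _, .r A => Fin.cast (Nat.zero_add (size A))
  | _, _, .rInv A => Fin.cast (Nat.zero_add (size A)).symm
  | _, _, .c A B => Fin.addCases (fun j => Fin.natAdd (size A) j) (fun i => Fin.castAdd (size B) i)
  | _, _, .ψL A B => Fin.cast (Nat.add_assoc (size B) (size A) 1).symm
  | _, _, .ψR A B =>
      Fin.addCases
        (Fin.lastCases (Fin.last (size B + size A))
          (fun j => Fin.castSucc (Fin.castAdd (size A) j)))
        (fun i => Fin.castSucc (Fin.natAdd (size B) i))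
  | _, _, .η _ => Fin.castSucc
  | _, _, .μ A => Fin.lastCases (Fin.last (size A)) (fun i => i)

/-- The same function on the underlying natural numbers, used to check that `gmap` respects the
equations. -/
def nmap : ∀ {A B : LcS P}, Term A B → ℕ → ℕ
  | _, _, .id _, n => n
  | _, _, .comp f g, n => nmap g (nmap f n)
  | _, _, @Term.tensor _ _ _ B B' f g, n =>
      if n < size B then nmap g n else size B' + nmap f (n - size B)
  | _, _, @Term.map _ A B f, n => if n = size A then size B else nmap f n
  | _, _, .a _ _ _, n => n
  | _, _, .aInv _ _ _, n => n
  | _, _, .l _, n => n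
  | _, _, .lInv _, n => n
  | _, _, .r _, n => n
  | _, _, .rInv _, n => n
  | _, _, .c A B, n => if n < size B then size A + n else n - size B
  | _, _, .ψL _ _, n => n
  | _, _, .ψR A B, n => if n < size B then n else if n = size B then size B + size A else n - 1
  | _, _, .η _, n => n
  | _, _, .μ A, n => if n = size A + 1 then size A else n

theorem addCases_val {m n k : ℕ} (f : Fin m → Fin k) (g : Fin n → Fin k) (φ : ℕ → ℕ)
    (hf : ∀ j : Fin m, (f j).val = φ j.val) (hg : ∀ i : Fin n, (g i).val = φ (m + i.val))
    (x : Fin (m + n)) : (Fin.addCases (motive := fun _ => Fin k) f g x).val = φ x.val := by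
  refine Fin.addCases (fun j => ?_) (fun i => ?_) x
  · simp [hf]
  · simp [hg]

theorem lastCases_val {m k : ℕ} (a : Fin k) (f : Fin m → Fin k) (φ : ℕ → ℕ)
    (ha : a.val = φ m) (hf : ∀ j : Fin m, (f j).val = φ j.val) (x : Fin (m + 1)) :
    (Fin.lastCases (motive := fun _ => Fin k) a f x).val = φ x.val := by
  refine Fin.lastCases ?_ (fun j => ?_) x
  · simp [ha]
  · simp [hf]

theorem gmap_val {A B : LcS P} (f : Term A B) (x : Fin (size A)) :
    (gmap f x).val = nmap f x.val := by
  induction f with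
  | id A => rfl
  | comp f g hf hg => simp only [gmap, nmap, hg, hf]
  | tensor f g hf hg =>
    refine addCases_val _ _ (nmap (f.tensor g)) (fun j => ?_) (fun i => ?_) x
    · simp [nmap, hg]
    · simp [nmap, hf]
  | map f hf =>
    refine lastCases_val _ _ (nmap f.map) ?_ (fun j => ?_) x
    · simp [nmap]
    · simp [nmap, hf, Nat.ne_of_lt j.isLt]
  | c A B =>
    refine addCases_val _ _ (nmap (Term.c A B)) (fun j => ?_) (fun i => ?_) x
    · simp [nmap]
    · simp [nmap]
  | ψR A B =>
    refine addCases_val _ _ (nmap (Term.ψR A B)) ?_ (fun i => ?_) x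
    · refine lastCases_val _ _ (nmap (Term.ψR A B)) ?_ (fun j => ?_)
      · simp [nmap]
      · simp [nmap]
        rfl
    · have h : nmap (Term.ψR A B) (size B + 1 + i.val) = size B + i.val := by
        simp only [nmap]
        rw [if_neg (by omega), if_neg (by omega)]
        omega
      exact h.symm
  | μ A =>
    refine lastCases_val _ _ (nmap (Term.μ A)) ?_ (fun j => ?_) x
    · simp [nmap, size]
    · have := j.isLt
      simp only [size] at this
      simp only [nmap]
      split_ifs <;> omega
  | _ => rfl

theorem nmap_lt {A B : LcS P} (f : Term A B) {n : ℕ} (h : n < size A) : nmap f n < size B := by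
  rw [← gmap_val f ⟨n, h⟩]
  exact (gmap f ⟨n, h⟩).isLt

theorem nmap_eq {A B : LcS P} {f g : Term A B} (h : Eqv f g) :
    ∀ n, n < size A → nmap f n = nmap g n := by
  induction h with
  | refl f => exact fun _ _ => rfl
  | symm _ ih => exact fun n hn => (ih n hn).symm
  | trans _ _ ih ih' => exact fun n hn => (ih n hn).trans (ih' n hn)
  | @comp A B C f f' g g' _ _ ih ih' =>
    intro n hn
    simp only [nmap]
    rw [ih n hn, ih' _ (nmap_lt f' hn)]
  | map_comp f g =>
    intro n hn
    have := @nmap_lt _ _ _ f n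
    grind [nmap, size]
  | @μ_natural A B f =>
    intro n hn
    have := @nmap_lt _ _ _ f n
    grind [nmap, size]
  | _ =>
    intro n hn
    grind [nmap, size, nmap_lt]

theorem gmap_eq {A B : LcS P} {f g : Term A B} (h : Eqv f g) : gmap f = gmap g := by
  funext x
  apply Fin.ext
  rw [gmap_val, gmap_val, nmap_eq h x.val x.isLt]

/-- The functor `G` to the category of functions between finite ordinals. -/
def G (P : Type u) : LcS P ⥤ FintypeCat.Skeleton.{0} where
  obj A := FintypeCat.Skeleton.mk (size A)
  map := Quotient.lift (fun f x => ULift.up (gmap f x.down))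
    (fun _ _ h => by rw [gmap_eq h])
  map_id _ := rfl
  map_comp := by rintro A B C ⟨f⟩ ⟨g⟩; rfl

end LcS

/-! Every arrow has a normal form dictated by its target, and this normal form can be read off from
the action of the arrow on occurrences. An arrow into `I` or into a letter is a canonical structural
isomorphism. An arrow into `B₁ ⊗ B₂` distributes the letters and the outermost `T`s of its source
over two sides (`Split`) and continues separately on each side. An arrow into `T B` chooses the
occurrences of `T` that are to end in the outer `T` (`Strip`), merges them by means of `η`, `μ` and
`TA ⊗ TB ⟶ T (A ⊗ B)`, and continues under `T` with what remains.

Existence (`normal`) is a form of cut elimination. Normal arrows absorb structural isomorphisms at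
the source (`Normal.sym_comp`), include the identities (`normal_id`) and are closed under
postcomposition with every arrow term (`Normal.comp_mk`). The equality of the two maps `TA ⊗ TB ⟶ T
(A ⊗ B)` enters through `dbl_braiding` and `mult_dbl`.

Uniqueness (`Normal.eq`) is an induction. The occurrences sent to the left factor determine the
`Split`, those not sent to the outer `T` determine the `Strip`, and the actions of the remaining
components are then determined as well. Since occurrences have distinct numbers, `G` determines the
action on occurrences (`trace_eq_of_G_map_eq`). -/

section Symmetric

/-! ### Symmetric monoidal identities for the middle-four interchange `tensorμ`. -/

variable {C : Type u} [Category.{v} C] [MonoidalCategory C] [SymmetricCategory C]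

theorem braiding_tensorμ (X₁ X₂ Y₁ Y₂ : C) :
    (β_ (X₁ ⊗ X₂) (Y₁ ⊗ Y₂)).hom ≫ tensorμ Y₁ Y₂ X₁ X₂ =
      tensorμ X₁ X₂ Y₁ Y₂ ≫ ((β_ X₁ Y₁).hom ⊗ₘ (β_ X₂ Y₂).hom) := by
  have h : Y₁ ◁ (β_ X₁ Y₂).hom ▷ X₂ ≫ Y₁ ◁ (β_ Y₂ X₁).hom ▷ X₂ = 𝟙 _ := by
    rw [← MonoidalCategory.whiskerLeft_comp, ← comp_whiskerRight, SymmetricCategory.symmetry]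
    simp
  simp [tensorμ, SymmetricCategory.braiding_swap_eq_inv_braiding Y₁ X₂,
    MonoidalCategory.tensorHom_def, reassoc_of% h]

/-- The interchange only swaps two copies of the unit, and that braiding is a composite of unitors,
so monoidal coherence suffices. -/
theorem unitors_inv_tensorμ_unitors (A B : C) :
    ((ρ_ A).inv ⊗ₘ (λ_ B).inv) ≫ tensorμ A (𝟙_ C) (𝟙_ C) B ≫ ((ρ_ A).hom ⊗ₘ (λ_ B).hom) =
      𝟙 (A ⊗ B) := by
  simp only [tensorμ, braiding_tensorUnit_left]
  monoidal

/-- Makes `a⁻¹` redundant in the presence of `a` and `c`, so that inductions over structural arrows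
need no case for it. -/
theorem associator_inv_eq_braiding (A B D : C) :
    (α_ A B D).inv = (β_ A (B ⊗ D)).hom ≫ (α_ B D A).hom ≫ (β_ B (D ⊗ A)).hom ≫
      (α_ D A B).hom ≫ (β_ D (A ⊗ B)).hom := by
  have h : B ◁ (β_ A D).hom ≫ (β_ B (D ⊗ A)).hom = (β_ B (A ⊗ D)).hom ≫ (β_ A D).hom ▷ B :=
    BraidedCategory.braiding_naturality_right B (β_ A D).hom
  have h₁ : (β_ A B).hom ▷ D ≫ (β_ B A).hom ▷ D = 𝟙 _ := by
    rw [← comp_whiskerRight, SymmetricCategory.symmetry, id_whiskerRight]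
  have h₂ : (β_ A D).hom ▷ B ≫ (β_ D A).hom ▷ B = 𝟙 _ := by
    rw [← comp_whiskerRight, SymmetricCategory.symmetry, id_whiskerRight]
  have h₃ : A ◁ (β_ B D).hom ≫ A ◁ (β_ D B).hom = 𝟙 _ := by
    rw [← MonoidalCategory.whiskerLeft_comp, SymmetricCategory.symmetry,
      MonoidalCategory.whiskerLeft_id]
  simp only [BraidedCategory.braiding_tensor_right_hom A B D, Category.assoc,
    Iso.inv_hom_id_assoc, reassoc_of% h]
  simp [h₁, reassoc_of% h₂, reassoc_of% h₃]

/-- This lemma and the `associator`, `leftUnitor` and `braiding` lemmas after it are the cases of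
`Sym.split`: each moves a structural arrow past a distribution over two sides. -/
theorem tensorHom_comp_splits {A A' B B' X₁ X₂ Y₁ Y₂ X₁' X₂' Y₁' Y₂' : C} {f : A ⟶ A'}
    {g : B ⟶ B'} {x : A ⟶ X₁ ⊗ X₂} {y : B ⟶ Y₁ ⊗ Y₂} {x' : A' ⟶ X₁' ⊗ X₂'} {y' : B' ⟶ Y₁' ⊗ Y₂'}
    {f₁ : X₁ ⟶ X₁'} {f₂ : X₂ ⟶ X₂'} {g₁ : Y₁ ⟶ Y₁'} {g₂ : Y₂ ⟶ Y₂'}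
    (hf : f ≫ x' = x ≫ (f₁ ⊗ₘ f₂)) (hg : g ≫ y' = y ≫ (g₁ ⊗ₘ g₂)) :
    (f ⊗ₘ g) ≫ (x' ⊗ₘ y') ≫ tensorμ X₁' X₂' Y₁' Y₂' =
      ((x ⊗ₘ y) ≫ tensorμ X₁ X₂ Y₁ Y₂) ≫ ((f₁ ⊗ₘ g₁) ⊗ₘ (f₂ ⊗ₘ g₂)) := by
  rw [tensorHom_comp_tensorHom_assoc, hf, hg, Category.assoc, ← tensorμ_natural,
    tensorHom_comp_tensorHom_assoc]

theorem associator_comp_splits {A B D X₁ X₂ Y₁ Y₂ Z₁ Z₂ : C} (x : A ⟶ X₁ ⊗ X₂)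
    (y : B ⟶ Y₁ ⊗ Y₂) (z : D ⟶ Z₁ ⊗ Z₂) :
    (α_ A B D).hom ≫ (x ⊗ₘ ((y ⊗ₘ z) ≫ tensorμ Y₁ Y₂ Z₁ Z₂)) ≫
        tensorμ X₁ X₂ (Y₁ ⊗ Z₁) (Y₂ ⊗ Z₂) =
      ((((x ⊗ₘ y) ≫ tensorμ X₁ X₂ Y₁ Y₂) ⊗ₘ z) ≫ tensorμ (X₁ ⊗ Y₁) (X₂ ⊗ Y₂) Z₁ Z₂) ≫
        ((α_ X₁ Y₁ Z₁).hom ⊗ₘ (α_ X₂ Y₂ Z₂).hom) := by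
  have h := tensor_associativity X₁ X₂ Y₁ Y₂ Z₁ Z₂
  have h₁ : x ⊗ₘ ((y ⊗ₘ z) ≫ tensorμ Y₁ Y₂ Z₁ Z₂) =
      (x ⊗ₘ (y ⊗ₘ z)) ≫ (X₁ ⊗ X₂) ◁ tensorμ Y₁ Y₂ Z₁ Z₂ := by
    rw [← id_tensorHom, tensorHom_comp_tensorHom, Category.comp_id]
  have h₂ : ((x ⊗ₘ y) ≫ tensorμ X₁ X₂ Y₁ Y₂) ⊗ₘ z =
      ((x ⊗ₘ y) ⊗ₘ z) ≫ tensorμ X₁ X₂ Y₁ Y₂ ▷ (Z₁ ⊗ Z₂) := by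
    rw [← tensorHom_id, tensorHom_comp_tensorHom, Category.comp_id]
  rw [h₁, h₂, Category.assoc, ← associator_naturality_assoc, ← h]
  simp only [Category.assoc]

theorem leftUnitor_comp_split {A X₁ X₂ : C} (x : A ⟶ X₁ ⊗ X₂) :
    (λ_ A).hom ≫ x = (((λ_ (𝟙_ C)).inv ⊗ₘ x) ≫ tensorμ (𝟙_ C) (𝟙_ C) X₁ X₂) ≫
      ((λ_ X₁).hom ⊗ₘ (λ_ X₂).hom) := by
  have h : (λ_ (𝟙_ C)).inv ⊗ₘ x = (𝟙 _ ⊗ₘ x) ≫ (λ_ (𝟙_ C)).inv ▷ (X₁ ⊗ X₂) := by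
    rw [← tensorHom_id, tensorHom_comp_tensorHom, Category.comp_id, Category.id_comp]
  rw [h, Category.assoc, Category.assoc, ← tensor_left_unitality, id_tensorHom,
    leftUnitor_naturality]

theorem leftUnitor_inv_comp_splits {A X₁ X₂ : C} (x : A ⟶ X₁ ⊗ X₂) :
    (λ_ A).inv ≫ ((λ_ (𝟙_ C)).inv ⊗ₘ x) ≫ tensorμ (𝟙_ C) (𝟙_ C) X₁ X₂ =
      x ≫ ((λ_ X₁).inv ⊗ₘ (λ_ X₂).inv) := by
  rw [Iso.inv_comp_eq, ← cancel_mono ((λ_ X₁).hom ⊗ₘ (λ_ X₂).hom), ← leftUnitor_comp_split]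
  simp

theorem braiding_comp_splits {A B X₁ X₂ Y₁ Y₂ : C} (x : A ⟶ X₁ ⊗ X₂) (y : B ⟶ Y₁ ⊗ Y₂) :
    (β_ A B).hom ≫ (y ⊗ₘ x) ≫ tensorμ Y₁ Y₂ X₁ X₂ =
      ((x ⊗ₘ y) ≫ tensorμ X₁ X₂ Y₁ Y₂) ≫ ((β_ X₁ Y₁).hom ⊗ₘ (β_ X₂ Y₂).hom) := by
  rw [← BraidedCategory.braiding_naturality_assoc, braiding_tensorμ, Category.assoc]

/-- The first source goes wholly to the left and the second wholly to the right; `n` and `n'`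
discard the units left on the other sides. -/
theorem tensorHom_eq_comp_splits {A A' B B' X Z X' Z' : C} (f : A ⟶ B) (g : A' ⟶ B')
    {x : A ⟶ X ⊗ Z} {x' : A' ⟶ Z' ⊗ X'} {h : X ⟶ A} {n : Z ⟶ 𝟙_ C} {h' : X' ⟶ A'}
    {n' : Z' ⟶ 𝟙_ C} (hx : x ≫ (h ⊗ₘ n) = (ρ_ A).inv) (hx' : x' ≫ (n' ⊗ₘ h') = (λ_ A').inv) :
    f ⊗ₘ g = ((x ⊗ₘ x') ≫ tensorμ X Z Z' X') ≫
      ((((h ⊗ₘ n') ≫ (ρ_ A).hom) ≫ f) ⊗ₘ (((n ⊗ₘ h') ≫ (λ_ A').hom) ≫ g)) := by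
  rw [← tensorHom_comp_tensorHom, ← tensorHom_comp_tensorHom, Category.assoc, Category.assoc,
    ← tensorμ_natural_assoc, tensorHom_comp_tensorHom_assoc, hx, hx',
    ← Category.assoc, ← Category.assoc, Category.assoc (_ ⊗ₘ _),
    unitors_inv_tensorμ_unitors, Category.id_comp]

end Symmetric

/-! ### The monad as a symmetric monoidal functor with monoidal unit and multiplication. -/

namespace SymmetricMonoidalMonad

variable {C : Type u} [Category.{v} C] [MonoidalCategory C] [SymmetricCategory C]
  (M : SymmetricMonoidalMonad C)

/-- The unit of the monad, as a morphism between literal objects. -/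
def unit (A : C) : A ⟶ M.obj A := M.η.app A

/-- The multiplication of the monad, as a morphism between literal objects. -/
def mult (A : C) : M.obj (M.obj A) ⟶ M.obj A := M.μ.app A

theorem unit_map {A B : C} (f : A ⟶ B) : M.unit A ≫ M.map f = f ≫ M.unit B :=
  (M.η.naturality f).symm

theorem mult_map {A B : C} (f : A ⟶ B) : M.mult A ≫ M.map f = M.map (M.map f) ≫ M.mult B :=
  (M.μ.naturality f).symm

theorem map_mult_mult (A : C) : M.map (M.mult A) ≫ M.mult A = M.mult (M.obj A) ≫ M.mult A :=
  M.assoc A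

theorem unit_mult (A : C) : M.unit (M.obj A) ≫ M.mult A = 𝟙 (M.obj A) := M.left_unit A

theorem map_unit_mult (A : C) : M.map (M.unit A) ≫ M.mult A = 𝟙 (M.obj A) := M.right_unit A

theorem unit_ψL (A B : C) : (M.unit A ⊗ₘ 𝟙 B) ≫ M.ψL A B = M.unit (A ⊗ B) := M.ψL_η A B

theorem unit_ψR (A B : C) : (𝟙 A ⊗ₘ M.unit B) ≫ M.ψR A B = M.unit (A ⊗ B) := M.ψR_η A B

theorem mult_ψL (A B : C) :
    (M.mult A ⊗ₘ 𝟙 B) ≫ M.ψL A B = M.ψL (M.obj A) B ≫ M.map (M.ψL A B) ≫ M.mult (A ⊗ B) :=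
  M.ψL_μ A B

theorem mult_ψR (A B : C) :
    (𝟙 A ⊗ₘ M.mult B) ≫ M.ψR A B = M.ψR A (M.obj B) ≫ M.map (M.ψR A B) ≫ M.mult (A ⊗ B) :=
  M.ψR_μ A B

theorem ψR_ψL_mult (A B : C) :
    M.ψR (M.obj A) B ≫ M.map (M.ψL A B) ≫ M.mult (A ⊗ B) =
      M.ψL A (M.obj B) ≫ M.map (M.ψR A B) ≫ M.mult (A ⊗ B) :=
  M.ψLψR_μ A B

theorem map_ψL {A A' B : C} (f : A ⟶ A') :
    (M.map f ⊗ₘ 𝟙 B) ≫ M.ψL A' B = M.ψL A B ≫ M.map (f ⊗ₘ 𝟙 B) := M.ψL_natural f (𝟙 B)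

theorem id_ψL {A B B' : C} (f : B ⟶ B') :
    (𝟙 (M.obj A) ⊗ₘ f) ≫ M.ψL A B' = M.ψL A B ≫ M.map (𝟙 A ⊗ₘ f) := by
  rw [← M.ψL_natural, M.map_id]

theorem map_ψR {A B B' : C} (f : B ⟶ B') :
    (𝟙 A ⊗ₘ M.map f) ≫ M.ψR A B' = M.ψR A B ≫ M.map (𝟙 A ⊗ₘ f) := M.ψR_natural (𝟙 A) f

theorem ψR_braiding (A B : C) :
    M.ψR A B ≫ M.map (β_ A B).hom = (β_ A (M.obj B)).hom ≫ M.ψL B A := by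
  rw [← cancel_epi (β_ (M.obj B) A).hom, ← reassoc_of% (M.ψLψR_c B A), ← M.map_comp]
  simp

/-- The monoidal structure map of the monad. -/
def dbl (A B : C) : M.obj A ⊗ M.obj B ⟶ M.obj (A ⊗ B) :=
  M.ψL A (M.obj B) ≫ M.map (M.ψR A B) ≫ M.mult (A ⊗ B)

theorem dbl_natural {A A' B B' : C} (f : A ⟶ A') (g : B ⟶ B') :
    (M.map f ⊗ₘ M.map g) ≫ M.dbl A' B' = M.dbl A B ≫ M.map (f ⊗ₘ g) := by
  simp only [dbl, Category.assoc]
  rw [reassoc_of% M.ψL_natural, ← M.map_comp_assoc, M.ψR_natural, M.map_comp_assoc, mult_map]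

/-- With `dbl_unit`, this recovers both strengths from `dbl`, so normal forms can be built from
`dbl` alone. -/
theorem unit_dbl (A B : C) : (M.unit A ⊗ₘ 𝟙 (M.obj B)) ≫ M.dbl A B = M.ψR A B := by
  simp only [dbl]
  rw [reassoc_of% M.unit_ψL, reassoc_of% M.unit_map, unit_mult, Category.comp_id]

theorem dbl_unit (A B : C) : (𝟙 (M.obj A) ⊗ₘ M.unit B) ≫ M.dbl A B = M.ψL A B := by
  simp only [dbl]
  rw [reassoc_of% M.id_ψL, ← M.map_comp_assoc, unit_ψR, map_unit_mult, Category.comp_id]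

theorem unit_unit_dbl (A B : C) : (M.unit A ⊗ₘ M.unit B) ≫ M.dbl A B = M.unit (A ⊗ B) := by
  have h : M.unit A ⊗ₘ M.unit B = (M.unit A ⊗ₘ 𝟙 B) ≫ (𝟙 (M.obj A) ⊗ₘ M.unit B) := by
    simp [MonoidalCategory.tensorHom_def]
  rw [h, Category.assoc, dbl_unit, unit_ψL]

/-- The braiding exchanges the two strengths, turning `dbl` into the composite taken in the other
order; `ψR_ψL_mult` identifies the two. -/
theorem dbl_braiding (A B : C) :
    M.dbl A B ≫ M.map (β_ A B).hom = (β_ (M.obj A) (M.obj B)).hom ≫ M.dbl B A := by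
  simp only [dbl, Category.assoc]
  rw [mult_map, ← M.map_comp_assoc, ψR_braiding, M.map_comp_assoc,
    reassoc_of% (M.ψLψR_c A (M.obj B)), M.ψR_ψL_mult]

theorem mult_dbl (A B : C) :
    (M.mult A ⊗ₘ M.mult B) ≫ M.dbl A B =
      M.dbl (M.obj A) (M.obj B) ≫ M.map (M.dbl A B) ≫ M.mult (A ⊗ B) := by
  have h : M.mult A ⊗ₘ M.mult B =
      (M.mult A ⊗ₘ 𝟙 (M.obj (M.obj B))) ≫ (𝟙 (M.obj A) ⊗ₘ M.mult B) := by
    simp [MonoidalCategory.tensorHom_def]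
  have e := congrArg (fun x => M.map (M.map x)) (M.mult_ψR A B)
  simp only [M.map_comp] at e
  have lhs : (M.mult A ⊗ₘ M.mult B) ≫ M.dbl A B = M.ψL (M.obj A) (M.obj (M.obj B)) ≫
      (M.map (M.ψL A (M.obj (M.obj B))) ≫ M.map (M.map (M.ψR A (M.obj B))) ≫
        M.map (M.mult (A ⊗ M.obj B))) ≫ M.map (M.map (M.ψR A B)) ≫ M.mult _ ≫ M.mult _ := by
    rw [h]
    simp only [dbl, Category.assoc]
    rw [reassoc_of% M.id_ψL, reassoc_of% M.mult_ψL, reassoc_of% M.mult_map, reassoc_of% M.mult_map,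
      reassoc_of% e]
    rw [← reassoc_of% M.mult_map (M.mult (A ⊗ B)), map_mult_mult,
      ← M.map_comp_assoc (M.mult _), mult_map, M.map_comp_assoc, reassoc_of% M.map_mult_mult]
  -- Commutativity swaps the inner pair of strengths; the rest is naturality and associativity of
  -- the multiplication.
  rw [lhs, ← M.map_comp, ← M.map_comp, ← M.ψR_ψL_mult]
  simp only [dbl, M.map_comp, Category.assoc]
  rw [← M.map_comp_assoc (M.mult _), mult_map]
  simp only [M.map_comp, Category.assoc, reassoc_of% M.mult_map]
  rw [← map_mult_mult, ← M.map_comp_assoc (M.mult _), ← map_mult_mult, M.map_comp_assoc]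

/-- Each of the three associativity laws `ψL_a`, `ψLψR_a`, `ψR_a` is used once, at successive depths
under `T`; commutativity is not needed. -/
theorem dbl_associator (A B D : C) :
    (M.dbl A B ⊗ₘ 𝟙 (M.obj D)) ≫ M.dbl (A ⊗ B) D ≫ M.map (α_ A B D).hom =
      (α_ (M.obj A) (M.obj B) (M.obj D)).hom ≫ (𝟙 (M.obj A) ⊗ₘ M.dbl B D) ≫ M.dbl A (B ⊗ D) := by
  have h1 : M.dbl A B ⊗ₘ 𝟙 (M.obj D) = (M.ψL A (M.obj B) ⊗ₘ 𝟙 (M.obj D)) ≫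
      (M.map (M.ψR A B) ⊗ₘ 𝟙 (M.obj D)) ≫ (M.mult (A ⊗ B) ⊗ₘ 𝟙 (M.obj D)) := by
    simp [dbl]
  have h2 : 𝟙 A ⊗ₘ M.dbl B D = (𝟙 A ⊗ₘ M.ψL B (M.obj D)) ≫
        (𝟙 A ⊗ₘ M.map (M.ψR B D)) ≫ (𝟙 A ⊗ₘ M.mult (B ⊗ D)) := by
    simp [dbl]
  have h3 := congrArg (fun x => M.map x) (M.map_ψR (A := A) (M.ψR B D))
  have h5 := congrArg (fun x => M.map x) (M.ψLψR_a A B (M.obj D))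
  have h6 := congrArg (fun x => M.map (M.map x)) (M.ψR_a A B D)
  have h7 := congrArg (fun x => M.map x) (M.mult_ψR A (B ⊗ D))
  have h8 := M.ψL_a A (M.obj B) (M.obj D)
  simp only [M.map_comp] at h3 h5 h6 h7
  have lhs : (M.dbl A B ⊗ₘ 𝟙 (M.obj D)) ≫ M.dbl (A ⊗ B) D ≫ M.map (α_ A B D).hom = 
     (M.ψL A (M.obj B) ⊗ₘ 𝟙 (M.obj D)) ≫ M.ψL (A ⊗ M.obj B) (M.obj D) ≫
      M.map (M.ψR A B ⊗ₘ 𝟙 (M.obj D)) ≫ M.map (M.ψL (A ⊗ B) (M.obj D)) ≫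
      M.map (M.map (M.ψR (A ⊗ B) D)) ≫ M.map (M.map (M.map (α_ A B D).hom)) ≫ M.mult _ ≫ M.mult _ := by
    rw [h1]
    simp only [dbl, Category.assoc]
    rw [reassoc_of% M.mult_ψL, reassoc_of% M.map_ψL, M.mult_map, reassoc_of% M.mult_map,
      reassoc_of% M.mult_map]
  rw [lhs, reassoc_of% h6, reassoc_of% h5, reassoc_of% h8]
  have rhs : (𝟙 (M.obj A) ⊗ₘ M.dbl B D) ≫ M.dbl A (B ⊗ D) =
      M.ψL A (M.obj B ⊗ M.obj D) ≫ M.map (𝟙 A ⊗ₘ M.ψL B (M.obj D)) ≫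
        M.map (M.ψR A (B ⊗ M.obj D)) ≫ M.map (M.map (𝟙 A ⊗ₘ M.ψR B D)) ≫
        M.map (M.map (M.ψR A (B ⊗ D))) ≫ M.mult _ ≫ M.mult _ := by
    rw [dbl.eq_1 M A, reassoc_of% M.id_ψL, h2]
    simp only [M.map_comp, Category.assoc]
    rw [reassoc_of% h7, reassoc_of% h3, M.map_mult_mult]
  rw [rhs]

/-- The analogue for `Strip` of `tensorHom_comp_splits`: together with the associator, unitor and
braiding lemmas below, it supplies the cases of `Sym.strip`. -/
theorem tensorHom_comp_dbl {A A' B B' X Y X' Y' : C} {f : A ⟶ A'} {g : B ⟶ B'} {x : A ⟶ M.obj X}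
    {y : B ⟶ M.obj Y} {x' : A' ⟶ M.obj X'} {y' : B' ⟶ M.obj Y'} {f' : X ⟶ X'} {g' : Y ⟶ Y'}
    (hf : f ≫ x' = x ≫ M.map f') (hg : g ≫ y' = y ≫ M.map g') :
    (f ⊗ₘ g) ≫ (x' ⊗ₘ y') ≫ M.dbl X' Y' = ((x ⊗ₘ y) ≫ M.dbl X Y) ≫ M.map (f' ⊗ₘ g') := by
  rw [tensorHom_comp_tensorHom_assoc, hf, hg, Category.assoc, ← dbl_natural,
    tensorHom_comp_tensorHom_assoc]

theorem associator_comp_dbl {A B D X Y Z : C} (x : A ⟶ M.obj X) (y : B ⟶ M.obj Y)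
    (z : D ⟶ M.obj Z) :
    (α_ A B D).hom ≫ (x ⊗ₘ ((y ⊗ₘ z) ≫ M.dbl Y Z)) ≫ M.dbl X (Y ⊗ Z) =
      ((((x ⊗ₘ y) ≫ M.dbl X Y) ⊗ₘ z) ≫ M.dbl (X ⊗ Y) Z) ≫ M.map (α_ X Y Z).hom := by
  have h₁ : x ⊗ₘ ((y ⊗ₘ z) ≫ M.dbl Y Z) = (x ⊗ₘ (y ⊗ₘ z)) ≫ (𝟙 (M.obj X) ⊗ₘ M.dbl Y Z) := by
    rw [tensorHom_comp_tensorHom, Category.comp_id]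
  have h₂ : ((x ⊗ₘ y) ≫ M.dbl X Y) ⊗ₘ z = ((x ⊗ₘ y) ⊗ₘ z) ≫ (M.dbl X Y ⊗ₘ 𝟙 (M.obj Z)) := by
    rw [tensorHom_comp_tensorHom, Category.comp_id]
  rw [h₁, h₂, Category.assoc, ← associator_naturality_assoc, Category.assoc, Category.assoc,
    dbl_associator]

theorem leftUnitor_comp_dbl {A X : C} (x : A ⟶ M.obj X) :
    (λ_ A).hom ≫ x = ((M.unit (𝟙_ C) ⊗ₘ x) ≫ M.dbl (𝟙_ C) X) ≫ M.map (λ_ X).hom := by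
  have h : M.unit (𝟙_ C) ⊗ₘ x = (𝟙 _ ⊗ₘ x) ≫ (M.unit (𝟙_ C) ⊗ₘ 𝟙 _) := by
    rw [tensorHom_comp_tensorHom, Category.comp_id, Category.id_comp]
  rw [h, Category.assoc, Category.assoc, reassoc_of% M.unit_dbl, M.ψR_l, id_tensorHom,
    leftUnitor_naturality]

theorem leftUnitor_inv_comp_dbl {A X : C} (x : A ⟶ M.obj X) :
    (λ_ A).inv ≫ (M.unit (𝟙_ C) ⊗ₘ x) ≫ M.dbl (𝟙_ C) X = x ≫ M.map (λ_ X).inv := by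
  rw [Iso.inv_comp_eq, ← cancel_mono (M.map (λ_ X).hom), ← leftUnitor_comp_dbl]
  simp

theorem braiding_comp_dbl {A B X Y : C} (x : A ⟶ M.obj X) (y : B ⟶ M.obj Y) :
    (β_ A B).hom ≫ (y ⊗ₘ x) ≫ M.dbl Y X =
      ((x ⊗ₘ y) ≫ M.dbl X Y) ≫ M.map (β_ X Y).hom := by
  rw [← BraidedCategory.braiding_naturality_assoc, Category.assoc, dbl_braiding]

/-- Two successive mergings on a tensor product can be composed factor by factor, because `mult_dbl`
makes the multiplication monoidal. -/
theorem dbl_kleisli {A B X Y X' Y' W Z : C} {x : A ⟶ M.obj X} {y : B ⟶ M.obj Y}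
    {x' : X ⟶ M.obj X'} {y' : Y ⟶ M.obj Y'} {u : A ⟶ M.obj W} {v : B ⟶ M.obj Z}
    {f : W ⟶ X'} {g : Z ⟶ Y'} (hu : x ≫ M.map x' ≫ M.mult X' = u ≫ M.map f)
    (hv : y ≫ M.map y' ≫ M.mult Y' = v ≫ M.map g) :
    ((x ⊗ₘ y) ≫ M.dbl X Y) ≫ M.map ((x' ⊗ₘ y') ≫ M.dbl X' Y') ≫ M.mult (X' ⊗ Y') =
      ((u ⊗ₘ v) ≫ M.dbl W Z) ≫ M.map (f ⊗ₘ g) := by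
  rw [M.map_comp, Category.assoc, Category.assoc, ← reassoc_of% M.dbl_natural, ← M.mult_dbl,
    tensorHom_comp_tensorHom_assoc, tensorHom_comp_tensorHom_assoc, Category.assoc, Category.assoc,
    hu, hv, Category.assoc, ← M.dbl_natural, tensorHom_comp_tensorHom_assoc]

theorem ψL_eq_dbl {A B X : C} (x : A ⟶ M.obj X) :
    (x ⊗ₘ 𝟙 B) ≫ M.ψL X B = (x ⊗ₘ M.unit B) ≫ M.dbl X B := by
  rw [← dbl_unit, tensorHom_comp_tensorHom_assoc, Category.comp_id, Category.id_comp]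

theorem map_kleisli {A X W Z : C} {x : A ⟶ M.obj X} {y : X ⟶ M.obj W} {u : A ⟶ M.obj Z}
    {f : Z ⟶ W} (h : x ≫ M.map y ≫ M.mult W = u ≫ M.map f) :
    (M.map x ≫ M.mult X) ≫ M.map y ≫ M.mult W = (M.map u ≫ M.mult Z) ≫ M.map f := by
  rw [Category.assoc, reassoc_of% M.mult_map, ← map_mult_mult, Category.assoc, mult_map,
    ← M.map_comp_assoc, ← M.map_comp_assoc, ← M.map_comp_assoc, ← h, Category.assoc]

theorem unit_kleisli {X W : C} (y : X ⟶ M.obj W) : M.unit X ≫ M.map y ≫ M.mult W = y := by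
  rw [reassoc_of% M.unit_map, unit_mult, Category.comp_id]

end SymmetricMonoidalMonad

/-! ### Ingredients of normal forms, and how structural isomorphisms pass through them. -/

namespace LcS

variable {P : Type u}

/-- The isomorphisms generated by the symmetric monoidal structure alone. -/
inductive Sym : ∀ {A B : LcS P}, (A ⟶ B) → Prop
  | id (A : LcS P) : Sym (𝟙 A)
  | comp {A B C : LcS P} {f : A ⟶ B} {g : B ⟶ C} : Sym f → Sym g → Sym (f ≫ g)
  | tensor {A A' B B' : LcS P} {f : A ⟶ A'} {g : B ⟶ B'} : Sym f → Sym g → Sym (f ⊗ₘ g)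
  | a (A B C : LcS P) : Sym (α_ A B C).hom
  | l (A : LcS P) : Sym (λ_ A).hom
  | lInv (A : LcS P) : Sym (λ_ A).inv
  | c (A B : LcS P) : Sym (β_ A B).hom

/-- A distribution of the letters and outermost occurrences of `T` of a formula over two sides. -/
inductive Split : LcS P → Type u
  | letterL (p : P) : Split (letter p)
  | letterR (p : P) : Split (letter p)
  | I : Split I
  | tensor {A B : LcS P} (d : Split A) (e : Split B) : Split (A.tensor B)
  | TL (A : LcS P) : Split A.T
  | TR (A : LcS P) : Split A.T

/-- The left-hand part of a distribution. -/
def Split.left : ∀ {A : LcS P}, Split A → LcS P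
  | _, letterL p => letter p
  | _, letterR _ => LcS.I
  | _, I => LcS.I
  | _, tensor d e => d.left.tensor e.left
  | _, TL A => A.T
  | _, TR _ => LcS.I

/-- The right-hand part of a distribution. -/
def Split.right : ∀ {A : LcS P}, Split A → LcS P
  | _, letterL _ => LcS.I
  | _, letterR p => letter p
  | _, I => LcS.I
  | _, tensor d e => d.right.tensor e.right
  | _, TL _ => LcS.I
  | _, TR A => A.T

/-- The canonical arrow to the tensor product of the two parts of a distribution. -/
def Split.hom : ∀ {A : LcS P} (d : Split A), A ⟶ d.left ⊗ d.right
  | _, letterL p => (ρ_ (letter p)).inv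
  | _, letterR p => (λ_ (letter p)).inv
  | _, I => (λ_ (𝟙_ (LcS P))).inv
  | _, tensor d e => (d.hom ⊗ₘ e.hom) ≫ tensorμ d.left d.right e.left e.right
  | _, TL A => (ρ_ A.T).inv
  | _, TR A => (λ_ A.T).inv

/-- A set of occurrences of `T` in a formula, closed towards the outside. -/
inductive Strip : LcS P → Type u
  | letter (p : P) : Strip (letter p)
  | I : Strip I
  | tensor {A B : LcS P} (d : Strip A) (e : Strip B) : Strip (A.tensor B)
  | keep (A : LcS P) : Strip A.T
  | strip {A : LcS P} (d : Strip A) : Strip A.T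

/-- The formula obtained by deleting a set of occurrences of `T`. -/
def Strip.res : ∀ {A : LcS P}, Strip A → LcS P
  | _, letter p => LcS.letter p
  | _, I => LcS.I
  | _, tensor d e => d.res.tensor e.res
  | _, keep A => A.T
  | _, strip d => d.res

/-- The canonical arrow merging a set of occurrences of `T` into a single outermost one. -/
def Strip.hom : ∀ {A : LcS P} (d : Strip A), A ⟶ (monad P).obj d.res
  | _, letter p => (monad P).unit (LcS.letter p)
  | _, I => (monad P).unit LcS.I
  | _, tensor d e => (d.hom ⊗ₘ e.hom) ≫ (monad P).dbl d.res e.res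
  | _, keep A => (monad P).unit A.T
  | _, strip d => (monad P).map d.hom ≫ (monad P).mult d.res

/-- The canonical arrows to `I`. -/
inductive Null : ∀ {A : LcS P}, (A ⟶ 𝟙_ (LcS P)) → Prop
  | I : Null (𝟙 (𝟙_ (LcS P)))
  | tensor {A B : LcS P} {f : A ⟶ 𝟙_ (LcS P)} {g : B ⟶ 𝟙_ (LcS P)} :
      Null f → Null g → Null ((f ⊗ₘ g) ≫ (λ_ (𝟙_ (LcS P))).hom)

/-- The canonical arrows to a letter. -/
inductive Single (p : P) : ∀ {A : LcS P}, (A ⟶ letter p) → Prop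
  | id : Single p (𝟙 (letter p))
  | left {A B : LcS P} {f : A ⟶ letter p} {g : B ⟶ 𝟙_ (LcS P)} :
      Single p f → Null g → Single p ((f ⊗ₘ g) ≫ (ρ_ (letter p)).hom)
  | right {A B : LcS P} {f : A ⟶ 𝟙_ (LcS P)} {g : B ⟶ letter p} :
      Null f → Single p g → Single p ((f ⊗ₘ g) ≫ (λ_ (letter p)).hom)

/-- Arrows in normal form. -/
inductive Normal : ∀ {A B : LcS P}, (A ⟶ B) → Prop
  | null {A : LcS P} {f : A ⟶ 𝟙_ (LcS P)} : Null f → Normal f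
  | single {p : P} {A : LcS P} {f : A ⟶ letter p} : Single p f → Normal f
  | tensor {A B₁ B₂ : LcS P} (d : Split A) {f : d.left ⟶ B₁} {g : d.right ⟶ B₂} :
      Normal f → Normal g → Normal (d.hom ≫ (f ⊗ₘ g))
  | map {A B : LcS P} (e : Strip A) {f : e.res ⟶ B} :
      Normal f → Normal (e.hom ≫ (monad P).map f)

theorem Sym.r (A : LcS P) : Sym (ρ_ A).hom := by
  rw [← braiding_leftUnitor]
  exact (Sym.c _ _).comp (Sym.l _)

theorem Sym.rInv (A : LcS P) : Sym (ρ_ A).inv := by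
  rw [← leftUnitor_inv_braiding]
  exact (Sym.lInv _).comp (Sym.c _ _)

theorem Sym.aInv (A B C : LcS P) : Sym (α_ A B C).inv := by
  rw [associator_inv_eq_braiding]
  exact (Sym.c _ _).comp ((Sym.a _ _ _).comp ((Sym.c _ _).comp ((Sym.a _ _ _).comp (Sym.c _ _))))

theorem Sym.whiskerRight {A B : LcS P} {f : A ⟶ B} (h : Sym f) (C : LcS P) : Sym (f ▷ C) := by
  rw [← tensorHom_id]; exact h.tensor (Sym.id _)

theorem Sym.whiskerLeft {A B : LcS P} {f : A ⟶ B} (h : Sym f) (C : LcS P) : Sym (C ◁ f) := by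
  rw [← id_tensorHom]; exact (Sym.id _).tensor h

theorem Sym.tensorμ (A B C D : LcS P) : Sym (tensorμ A B C D) := by
  unfold MonoidalCategory.tensorμ
  exact (Sym.a _ _ _).comp (((Sym.aInv _ _ _).whiskerLeft _).comp
    ((((Sym.c _ _).whiskerRight _).whiskerLeft _).comp
      (((Sym.a _ _ _).whiskerLeft _).comp (Sym.aInv _ _ _))))

theorem Split.sym_hom {A : LcS P} (d : Split A) : Sym d.hom := by
  induction d with
  | letterL p => exact Sym.rInv _
  | letterR p => exact Sym.lInv _
  | I => exact Sym.lInv _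
  | tensor d e hd he => exact (hd.tensor he).comp (Sym.tensorμ _ _ _ _)
  | TL A => exact Sym.rInv _
  | TR A => exact Sym.lInv _

theorem Null.sym {A : LcS P} {f : A ⟶ 𝟙_ (LcS P)} (h : Null f) : Sym f := by
  induction h with
  | I => exact Sym.id _
  | tensor _ _ hf hg => exact (hf.tensor hg).comp (Sym.l _)

theorem Single.sym {p : P} {A : LcS P} {f : A ⟶ letter p} (h : Single p f) : Sym f := by
  induction h with
  | id => exact Sym.id _
  | left _ hg hf => exact (hf.tensor hg.sym).comp (Sym.r _)
  | right hf _ hg => exact (hf.sym.tensor hg).comp (Sym.l _)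

theorem Sym.isIso {A B : LcS P} {f : A ⟶ B} (h : Sym f) : IsIso f := by
  induction h <;> infer_instance

/-- A structural isomorphism carries the letters and outermost `T`s along, so a distribution of its
target pulls back to its source, with structural arrows on the two sides. -/
theorem Sym.split {A B : LcS P} {f : A ⟶ B} (h : Sym f) (d : Split B) :
    ∃ (e : Split A) (g₁ : e.left ⟶ d.left) (g₂ : e.right ⟶ d.right), Sym g₁ ∧ Sym g₂ ∧
      f ≫ d.hom = e.hom ≫ (g₁ ⊗ₘ g₂) := by
  induction h with
  | id A => exact ⟨d, 𝟙 _, 𝟙 _, Sym.id _, Sym.id _, by simp⟩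
  | comp _ _ hf hg =>
    obtain ⟨e, g₁, g₂, h₁, h₂, h⟩ := hg d
    obtain ⟨e', g₁', g₂', h₁', h₂', h'⟩ := hf e
    exact ⟨e', g₁' ≫ g₁, g₂' ≫ g₂, h₁'.comp h₁, h₂'.comp h₂, by
      rw [Category.assoc, h, reassoc_of% h', tensorHom_comp_tensorHom]⟩
  | tensor _ _ hf hg =>
    cases d with
    | tensor d d' =>
    obtain ⟨e, g₁, g₂, h₁, h₂, h⟩ := hf d
    obtain ⟨e', g₁', g₂', h₁', h₂', h'⟩ := hg d'
    exact ⟨e.tensor e', g₁ ⊗ₘ g₁', g₂ ⊗ₘ g₂', h₁.tensor h₁', h₂.tensor h₂',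
      tensorHom_comp_splits h h'⟩
  | a A B C =>
    cases d with
    | tensor d₁ d =>
    cases d with
    | tensor d₂ d₃ =>
    exact ⟨(d₁.tensor d₂).tensor d₃, _, _, Sym.a _ _ _, Sym.a _ _ _,
      associator_comp_splits d₁.hom d₂.hom d₃.hom⟩
  | l A => exact ⟨Split.I.tensor d, _, _, Sym.l _, Sym.l _, leftUnitor_comp_split d.hom⟩
  | lInv A =>
    cases d with
    | tensor d₁ d =>
    cases d₁ with
    | I => exact ⟨d, _, _, Sym.lInv _, Sym.lInv _, leftUnitor_inv_comp_splits d.hom⟩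
  | c A B =>
    cases d with
    | tensor d₁ d₂ =>
    exact ⟨d₂.tensor d₁, _, _, Sym.c _ _, Sym.c _ _, braiding_comp_splits d₂.hom d₁.hom⟩

/-- The occurrences of `T` chosen in the target pull back to the source, and merging commutes with
the structural arrow up to a structural arrow under `T`. -/
theorem Sym.strip {A B : LcS P} {f : A ⟶ B} (h : Sym f) (d : Strip B) :
    ∃ (e : Strip A) (g : e.res ⟶ d.res), Sym g ∧ f ≫ d.hom = e.hom ≫ (monad P).map g := by
  induction h with
  | id A => exact ⟨d, 𝟙 _, Sym.id _, by simp⟩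
  | comp _ _ hf hg =>
    obtain ⟨e, g, h₁, h⟩ := hg d
    obtain ⟨e', g', h₁', h'⟩ := hf e
    exact ⟨e', g' ≫ g, h₁'.comp h₁, by
      rw [Category.assoc, h, reassoc_of% h', Functor.map_comp]⟩
  | tensor _ _ hf hg =>
    cases d with
    | tensor d d' =>
    obtain ⟨e, g, h₁, h⟩ := hf d
    obtain ⟨e', g', h₁', h'⟩ := hg d'
    exact ⟨e.tensor e', g ⊗ₘ g', h₁.tensor h₁', (monad P).tensorHom_comp_dbl h h'⟩
  | a A B C =>
    cases d with
    | tensor d₁ d =>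
    cases d with
    | tensor d₂ d₃ =>
    exact ⟨(d₁.tensor d₂).tensor d₃, _, Sym.a _ _ _,
      (monad P).associator_comp_dbl d₁.hom d₂.hom d₃.hom⟩
  | l A => exact ⟨Strip.I.tensor d, _, Sym.l _, (monad P).leftUnitor_comp_dbl d.hom⟩
  | lInv A =>
    cases d with
    | tensor d₁ d =>
    cases d₁ with
    | I => exact ⟨d, _, Sym.lInv _, (monad P).leftUnitor_inv_comp_dbl d.hom⟩
  | c A B =>
    cases d with
    | tensor d₁ d₂ =>
    exact ⟨d₂.tensor d₁, _, Sym.c _ _, (monad P).braiding_comp_dbl d₂.hom d₁.hom⟩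

end LcS

/-! ### Distributions that put everything on one side. -/

theorem comp_id_tensorHom_id {C : Type u} [Category.{v} C] [MonoidalCategory C] {A X Y : C}
    (x : A ⟶ X ⊗ Y) : x ≫ (𝟙 X ⊗ₘ 𝟙 Y) = x := by
  rw [id_tensorHom_id, Category.comp_id]

section Symmetric

variable {C : Type u} [Category.{v} C] [MonoidalCategory C] [SymmetricCategory C]

theorem splits_comp_rightUnit {A B X Y Z W : C} {x : A ⟶ X ⊗ Z} {y : B ⟶ Y ⊗ W} {f : X ⟶ A}
    {g : Y ⟶ B} {m : Z ⟶ 𝟙_ C} {n : W ⟶ 𝟙_ C} (hx : x ≫ (f ⊗ₘ m) = (ρ_ A).inv)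
    (hy : y ≫ (g ⊗ₘ n) = (ρ_ B).inv) :
    ((x ⊗ₘ y) ≫ tensorμ X Z Y W) ≫ ((f ⊗ₘ g) ⊗ₘ ((m ⊗ₘ n) ≫ (λ_ (𝟙_ C)).hom)) =
      (ρ_ (A ⊗ B)).inv := by
  have h : (f ⊗ₘ g) ⊗ₘ ((m ⊗ₘ n) ≫ (λ_ (𝟙_ C)).hom) =
      ((f ⊗ₘ g) ⊗ₘ (m ⊗ₘ n)) ≫ (A ⊗ B) ◁ (λ_ (𝟙_ C)).hom := by
    rw [← id_tensorHom, tensorHom_comp_tensorHom, Category.comp_id]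
  rw [h, Category.assoc, ← tensorμ_natural_assoc, tensorHom_comp_tensorHom_assoc, hx, hy,
    ← cancel_mono (ρ_ (A ⊗ B)).hom, Category.assoc, Category.assoc,
    ← rightUnitor_monoidal]
  simp

theorem splits_comp_leftUnit {A B X Y Z W : C} {x : A ⟶ Z ⊗ X} {y : B ⟶ W ⊗ Y} {f : X ⟶ A}
    {g : Y ⟶ B} {m : Z ⟶ 𝟙_ C} {n : W ⟶ 𝟙_ C} (hx : x ≫ (m ⊗ₘ f) = (λ_ A).inv)
    (hy : y ≫ (n ⊗ₘ g) = (λ_ B).inv) :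
    ((x ⊗ₘ y) ≫ tensorμ Z X W Y) ≫ (((m ⊗ₘ n) ≫ (λ_ (𝟙_ C)).hom) ⊗ₘ (f ⊗ₘ g)) =
      (λ_ (A ⊗ B)).inv := by
  have h : ((m ⊗ₘ n) ≫ (λ_ (𝟙_ C)).hom) ⊗ₘ (f ⊗ₘ g) =
      ((m ⊗ₘ n) ⊗ₘ (f ⊗ₘ g)) ≫ (λ_ (𝟙_ C)).hom ▷ (A ⊗ B) := by
    rw [← tensorHom_id, tensorHom_comp_tensorHom, Category.comp_id]
  rw [h, Category.assoc, ← tensorμ_natural_assoc, tensorHom_comp_tensorHom_assoc, hx, hy,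
    ← cancel_mono (λ_ (A ⊗ B)).hom, Category.assoc, Category.assoc,
    ← leftUnitor_monoidal]
  simp

theorem SymmetricMonoidalMonad.comp_map_id (M : SymmetricMonoidalMonad C) {A X : C}
    (x : A ⟶ M.obj X) : x ≫ M.map (𝟙 X) = x := by
  rw [M.map_id, Category.comp_id]

end Symmetric

/-! ### Existence of normal forms. -/

namespace LcS

variable {P : Type u}

theorem Null.comp_sym {A B : LcS P} {f : A ⟶ B} (h : Sym f) {n : B ⟶ 𝟙_ (LcS P)} (hn : Null n) :
    Null (f ≫ n) := by
  induction h with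
  | id A => rwa [Category.id_comp]
  | comp _ _ hf hg => rw [Category.assoc]; exact hf (hg hn)
  | tensor _ _ hf hg =>
    cases hn with
    | tensor h₁ h₂ =>
    have := (hf h₁).tensor (hg h₂)
    rwa [← tensorHom_comp_tensorHom, Category.assoc] at this
  | a A B C =>
    cases hn with
    | @tensor _ _ n₁ _ h₁ h =>
    cases h with
    | @tensor _ _ n₂ n₃ h₂ h₃ =>
    have e : (α_ A B C).hom ≫ (n₁ ⊗ₘ ((n₂ ⊗ₘ n₃) ≫ (λ_ (𝟙_ (LcS P))).hom)) ≫
        (λ_ (𝟙_ (LcS P))).hom =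
        (((n₁ ⊗ₘ n₂) ≫ (λ_ (𝟙_ (LcS P))).hom) ⊗ₘ n₃) ≫ (λ_ (𝟙_ (LcS P))).hom := by monoidal
    exact e ▸ (h₁.tensor h₂).tensor h₃
  | l A =>
    have e : (λ_ A).hom ≫ n = (𝟙 _ ⊗ₘ n) ≫ (λ_ (𝟙_ (LcS P))).hom := by simp
    exact e ▸ Null.I.tensor hn
  | lInv A =>
    cases hn with
    | @tensor _ _ _ n h₁ h =>
    cases h₁ with
    | I =>
    have e : (λ_ A).inv ≫ (𝟙 _ ⊗ₘ n) ≫ (λ_ (𝟙_ (LcS P))).hom = n := by simp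
    exact e.symm ▸ h
  | c A B =>
    cases hn with
    | @tensor _ _ m n h₁ h₂ =>
    have e : (β_ A B).hom ≫ (m ⊗ₘ n) ≫ (λ_ (𝟙_ (LcS P))).hom =
        (n ⊗ₘ m) ≫ (λ_ (𝟙_ (LcS P))).hom := by
      rw [← BraidedCategory.braiding_naturality_assoc, braiding_leftUnitor, unitors_equal]
    exact e ▸ h₂.tensor h₁

theorem Single.comp_sym {p : P} {A B : LcS P} {f : A ⟶ B} (h : Sym f) {s : B ⟶ letter p}
    (hs : Single p s) : Single p (f ≫ s) := by
  induction h with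
  | id A => rwa [Category.id_comp]
  | comp _ _ hf hg => rw [Category.assoc]; exact hf (hg hs)
  | tensor h h' hf hg =>
    cases hs with
    | left h₁ h₂ =>
      have := (hf h₁).left (h₂.comp_sym h')
      rwa [← tensorHom_comp_tensorHom, Category.assoc] at this
    | right h₁ h₂ =>
      have := (hg h₂).right (h₁.comp_sym h)
      rwa [← tensorHom_comp_tensorHom, Category.assoc] at this
  | a A B C =>
    cases hs with
    | @left _ _ s₁ _ h₁ h =>
      cases h with
      | @tensor _ _ n₂ n₃ h₂ h₃ =>
      have e : (α_ A B C).hom ≫ (s₁ ⊗ₘ ((n₂ ⊗ₘ n₃) ≫ (λ_ (𝟙_ (LcS P))).hom)) ≫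
          (ρ_ (letter p)).hom =
          (((s₁ ⊗ₘ n₂) ≫ (ρ_ (letter p)).hom) ⊗ₘ n₃) ≫ (ρ_ (letter p)).hom := by monoidal
      exact e ▸ (h₁.left h₂).left h₃
    | @right _ _ n₁ _ h₁ h =>
      cases h with
      | @left _ _ s₂ n₃ h₂ h₃ =>
        have e : (α_ A B C).hom ≫ (n₁ ⊗ₘ ((s₂ ⊗ₘ n₃) ≫ (ρ_ (letter p)).hom)) ≫
            (λ_ (letter p)).hom =
            (((n₁ ⊗ₘ s₂) ≫ (λ_ (letter p)).hom) ⊗ₘ n₃) ≫ (ρ_ (letter p)).hom := by monoidal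
        exact e ▸ (h₂.right h₁).left h₃
      | @right _ _ n₂ s₃ h₂ h₃ =>
        have e : (α_ A B C).hom ≫ (n₁ ⊗ₘ ((n₂ ⊗ₘ s₃) ≫ (λ_ (letter p)).hom)) ≫
            (λ_ (letter p)).hom =
            (((n₁ ⊗ₘ n₂) ≫ (λ_ (𝟙_ (LcS P))).hom) ⊗ₘ s₃) ≫ (λ_ (letter p)).hom := by monoidal
        exact e ▸ h₃.right (h₁.tensor h₂)
  | l A =>
    have e : (λ_ A).hom ≫ s = (𝟙 _ ⊗ₘ s) ≫ (λ_ (letter p)).hom := by simp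
    exact e ▸ hs.right Null.I
  | lInv A =>
    cases hs with
    -- Impossible: no canonical arrow to a letter has source `I`.
    | left h₁ _ => cases h₁
    | @right _ _ _ s h₁ h =>
    cases h₁ with
    | I =>
    have e : (λ_ A).inv ≫ (𝟙 _ ⊗ₘ s) ≫ (λ_ (letter p)).hom = s := by simp
    exact e.symm ▸ h
  | c A B =>
    cases hs with
    | @left _ _ m n h₁ h₂ =>
      have e : (β_ A B).hom ≫ (m ⊗ₘ n) ≫ (ρ_ (letter p)).hom =
          (n ⊗ₘ m) ≫ (λ_ (letter p)).hom := by
        rw [← BraidedCategory.braiding_naturality_assoc, braiding_rightUnitor]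
      exact e ▸ h₁.right h₂
    | @right _ _ m n h₁ h₂ =>
      have e : (β_ A B).hom ≫ (m ⊗ₘ n) ≫ (λ_ (letter p)).hom =
          (n ⊗ₘ m) ≫ (ρ_ (letter p)).hom := by
        rw [← BraidedCategory.braiding_naturality_assoc, braiding_leftUnitor]
      exact e ▸ h₂.left h₁

/-- The structural arrow is pushed through the outer `Split` or `Strip`, and what comes out is
absorbed by the smaller normal arrows. The source must vary in the induction. -/
theorem Normal.sym_comp {A B : LcS P} {f : A ⟶ B} (hf : Normal f) {A' : LcS P} {s : A' ⟶ A}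
    (hs : Sym s) : Normal (s ≫ f) := by
  induction hf generalizing A' with
  | null h => exact .null (h.comp_sym hs)
  | single h => exact .single (h.comp_sym hs)
  | tensor d _ _ hf hg =>
    obtain ⟨e, g₁, g₂, h₁, h₂, h⟩ := hs.split d
    rw [reassoc_of% h, tensorHom_comp_tensorHom]
    exact .tensor e (hf h₁) (hg h₂)
  | map d _ hf =>
    obtain ⟨e, g, h₁, h⟩ := hs.strip d
    rw [reassoc_of% h, ← Functor.map_comp]
    exact .map e (hf h₁)

theorem exists_split_left (A : LcS P) :
    ∃ (d : Split A) (h : d.left ⟶ A) (n : d.right ⟶ 𝟙_ (LcS P)), Sym h ∧ Sym n ∧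
      d.hom ≫ (h ⊗ₘ n) = (ρ_ A).inv := by
  induction A with
  | letter p => exact ⟨.letterL p, 𝟙 _, 𝟙 _, .id _, .id _, comp_id_tensorHom_id _⟩
  -- `Split.hom` on `I` is the inverse left unitor, which agrees with the right one at the unit
  -- object.
  | I => exact ⟨.I, 𝟙 _, 𝟙 _, .id _, .id _, 
      (comp_id_tensorHom_id _).trans unitors_inv_equal⟩
  | tensor A B hA hB =>
    obtain ⟨d, h, n, hh, hn, e⟩ := hA
    obtain ⟨d', h', n', hh', hn', e'⟩ := hB
    exact ⟨d.tensor d', h ⊗ₘ h', (n ⊗ₘ n') ≫ (λ_ _).hom, hh.tensor hh', (hn.tensor hn').comp (.l _),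
      splits_comp_rightUnit e e'⟩
  | T A => exact ⟨.TL A, 𝟙 _, 𝟙 _, .id _, .id _, comp_id_tensorHom_id _⟩

theorem exists_split_right (A : LcS P) :
    ∃ (d : Split A) (n : d.left ⟶ 𝟙_ (LcS P)) (h : d.right ⟶ A), Sym n ∧ Sym h ∧
      d.hom ≫ (n ⊗ₘ h) = (λ_ A).inv := by
  induction A with
  | letter p => exact ⟨.letterR p, 𝟙 _, 𝟙 _, .id _, .id _, comp_id_tensorHom_id _⟩
  | I => exact ⟨.I, 𝟙 _, 𝟙 _, .id _, .id _, comp_id_tensorHom_id _⟩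
  | tensor A B hA hB =>
    obtain ⟨d, n, h, hn, hh, e⟩ := hA
    obtain ⟨d', n', h', hn', hh', e'⟩ := hB
    exact ⟨d.tensor d', (n ⊗ₘ n') ≫ (λ_ _).hom, h ⊗ₘ h', (hn.tensor hn').comp (.l _), hh.tensor hh',
      splits_comp_leftUnit e e'⟩
  | T A => exact ⟨.TR A, 𝟙 _, 𝟙 _, .id _, .id _, comp_id_tensorHom_id _⟩

theorem Normal.tensorHom {A B A' B' : LcS P} {f : A ⟶ B} {g : A' ⟶ B'} (hf : Normal f)
    (hg : Normal g) : Normal (f ⊗ₘ g) := by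
  obtain ⟨d, h, n, hh, hn, e⟩ := exists_split_left A
  obtain ⟨d', n', h', hn', hh', e'⟩ := exists_split_right A'
  rw [tensorHom_eq_comp_splits f g e e']
  exact .tensor (d.tensor d') (hf.sym_comp ((hh.tensor hn').comp (.r _)))
    (hg.sym_comp ((hn.tensor hh').comp (.l _)))

/-- Nothing is stripped: every `T` is kept, and the units on the atoms and kept `T`s combine by
`unit_unit_dbl`. -/
theorem exists_strip_unit (A : LcS P) :
    ∃ (e : Strip A) (h : e.res ⟶ A), Sym h ∧ (monad P).unit A = e.hom ≫ (monad P).map h := by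
  induction A with
  | letter p => exact ⟨.letter p, 𝟙 _, .id _, ((monad P).comp_map_id _).symm⟩
  | I => exact ⟨.I, 𝟙 _, .id _, ((monad P).comp_map_id _).symm⟩
  | tensor A B hA hB =>
    obtain ⟨e, h, hh, he⟩ := hA
    obtain ⟨e', h', hh', he'⟩ := hB
    refine ⟨e.tensor e', h ⊗ₘ h', hh.tensor hh', ?_⟩
    refine ((monad P).unit_unit_dbl A B).symm.trans ?_
    have := (monad P).tensorHom_comp_dbl ((Category.id_comp _).trans he)
      ((Category.id_comp _).trans he')
    rw [id_tensorHom_id, Category.id_comp] at this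
    exact this
  | T A => exact ⟨.keep A, 𝟙 _, .id _, ((monad P).comp_map_id _).symm⟩

/-- Two rounds of stripping amount to one. When `d.hom` is a unit, the second round alone serves as
`d'`. -/
theorem Strip.kleisli {A : LcS P} (d : Strip A) (e : Strip d.res) :
    ∃ (d' : Strip A) (h : d'.res ⟶ e.res), Sym h ∧
      d.hom ≫ (monad P).map e.hom ≫ (monad P).mult e.res = d'.hom ≫ (monad P).map h := by
  induction d with
  | letter p => exact ⟨e, 𝟙 _, .id _, 
      ((monad P).unit_kleisli e.hom).trans ((monad P).comp_map_id _).symm⟩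
  | I => exact ⟨e, 𝟙 _, .id _, 
      ((monad P).unit_kleisli e.hom).trans ((monad P).comp_map_id _).symm⟩
  | keep A => exact ⟨e, 𝟙 _, .id _, 
      ((monad P).unit_kleisli e.hom).trans ((monad P).comp_map_id _).symm⟩
  | tensor d₁ d₂ h₁ h₂ =>
    cases e with
    | tensor e₁ e₂ =>
    obtain ⟨d, h, hh, w⟩ := h₁ e₁
    obtain ⟨d', h', hh', w'⟩ := h₂ e₂
    exact ⟨d.tensor d', h ⊗ₘ h', hh.tensor hh', (monad P).dbl_kleisli w w'⟩
  | strip d hd =>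
    obtain ⟨d', h, hh, w⟩ := hd e
    exact ⟨d'.strip, h, hh, (monad P).map_kleisli w⟩

theorem normal_id (A : LcS P) : Normal (𝟙 A) := by
  induction A with
  | letter p => exact .single .id
  | I => exact .null .I
  | tensor A B hA hB =>
    have := hA.tensorHom hB
    rwa [id_tensorHom_id] at this
  | T A hA =>
    obtain ⟨e, h, hh, w⟩ := exists_strip_unit A
    -- The identity of `T A` is `T η` followed by `μ`; stripping just the outermost `T` expresses
    -- this composite.
    have : Normal (((monad P).map e.hom ≫ (monad P).mult e.res) ≫ (monad P).map (h ≫ 𝟙 A)) :=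
      .map e.strip (hA.sym_comp hh)
    rw [Category.comp_id, Category.assoc, SymmetricMonoidalMonad.mult_map, ← Functor.map_comp_assoc,
      ← w, SymmetricMonoidalMonad.map_unit_mult] at this
    exact this

/-- Normal arrows into a tensor product can only end with the `tensor` constructor. Unfolding it
twice lets `a` slide to the source, where it is absorbed as structural. -/
theorem Normal.comp_a {A B C X : LcS P} {f : X ⟶ (A ⊗ B) ⊗ C} (hf : Normal f) :
    Normal (f ≫ (α_ A B C).hom) := by
  cases hf with
  | @tensor _ _ _ d _ g hf hg =>
  cases hf with
  | @tensor _ _ _ d' f₁ f₂ h₁ h₂ =>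
  have e : (d.hom ≫ ((d'.hom ≫ (f₁ ⊗ₘ f₂)) ⊗ₘ g)) ≫ (α_ A B C).hom =
      (d.hom ≫ (d'.hom ⊗ₘ 𝟙 _) ≫ (α_ _ _ _).hom) ≫ (f₁ ⊗ₘ (f₂ ⊗ₘ g)) := by
    have h : (d'.hom ≫ (f₁ ⊗ₘ f₂)) ⊗ₘ g = (d'.hom ⊗ₘ 𝟙 _) ≫ ((f₁ ⊗ₘ f₂) ⊗ₘ g) := by
      rw [tensorHom_comp_tensorHom, Category.id_comp]
    rw [h, Category.assoc, Category.assoc, associator_naturality]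
    simp only [Category.assoc]
  exact e ▸ (h₁.tensorHom (h₂.tensorHom hg)).sym_comp
    (d.sym_hom.comp ((d'.sym_hom.tensor (.id _)).comp (.a _ _ _)))

/-- The component into `I` is canonical, hence structural, so it joins the part absorbed by the
other component. -/
theorem Normal.comp_l {A X : LcS P} {f : X ⟶ 𝟙_ (LcS P) ⊗ A} (hf : Normal f) :
    Normal (f ≫ (λ_ A).hom) := by
  cases hf with
  | @tensor _ _ _ d n g hf hg =>
  cases hf with
  | null hn =>
  have e : (d.hom ≫ (n ⊗ₘ g)) ≫ (λ_ A).hom =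
      (d.hom ≫ (n ⊗ₘ 𝟙 _) ≫ (λ_ _).hom) ≫ g := by
    have h : n ⊗ₘ g = (n ⊗ₘ 𝟙 _) ≫ (𝟙 _ ⊗ₘ g) := by
      rw [tensorHom_comp_tensorHom, Category.id_comp, Category.comp_id]
    rw [h, Category.assoc, Category.assoc, id_tensorHom, leftUnitor_naturality]
    simp only [Category.assoc]
  exact e ▸ hg.sym_comp (d.sym_hom.comp ((hn.sym.tensor (.id _)).comp (.l _)))

theorem Normal.comp_lInv {A X : LcS P} {f : X ⟶ A} (hf : Normal f) :
    Normal (f ≫ (λ_ A).inv) := by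
  have e : f ≫ (λ_ A).inv = (λ_ X).inv ≫ (𝟙 _ ⊗ₘ f) := by simp
  exact e ▸ ((normal_id _).tensorHom hf).sym_comp (.lInv _)

theorem Normal.comp_c {A B X : LcS P} {f : X ⟶ A ⊗ B} (hf : Normal f) :
    Normal (f ≫ (β_ A B).hom) := by
  cases hf with
  | @tensor _ _ _ d f g hf hg =>
  have e : (d.hom ≫ (f ⊗ₘ g)) ≫ (β_ A B).hom = (d.hom ≫ (β_ _ _).hom) ≫ (g ⊗ₘ f) := by
    simp
  exact e ▸ (hg.tensorHom hf).sym_comp (d.sym_hom.comp (.c _ _))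

theorem Normal.comp_aInv {A B C X : LcS P} {f : X ⟶ A ⊗ (B ⊗ C)} (hf : Normal f) :
    Normal (f ≫ (α_ A B C).inv) := by
  have := hf.comp_c.comp_a.comp_c.comp_a.comp_c
  simp only [Category.assoc] at this
  rwa [← associator_inv_eq_braiding A B C] at this

theorem Normal.comp_r {A X : LcS P} {f : X ⟶ A ⊗ 𝟙_ (LcS P)} (hf : Normal f) :
    Normal (f ≫ (ρ_ A).hom) := by
  have := hf.comp_c.comp_l
  rwa [Category.assoc, braiding_leftUnitor] at this

theorem Normal.comp_rInv {A X : LcS P} {f : X ⟶ A} (hf : Normal f) :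
    Normal (f ≫ (ρ_ A).inv) := by
  have := hf.comp_lInv.comp_c
  rwa [Category.assoc, leftUnitor_inv_braiding] at this

theorem Normal.comp_map {A B X : LcS P} {f : X ⟶ (monad P).obj A} (hf : Normal f) {g : A ⟶ B}
    (hg : ∀ {Y : LcS P} {h : Y ⟶ A}, Normal h → Normal (h ≫ g)) :
    Normal (f ≫ (monad P).map g) := by
  cases hf with
  | map e h =>
  rw [Category.assoc, ← Functor.map_comp]
  exact .map e (hg h)

theorem Normal.comp_unit {A X : LcS P} {f : X ⟶ A} (hf : Normal f) :
    Normal (f ≫ (monad P).unit A) := by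
  obtain ⟨e, h, hh, w⟩ := exists_strip_unit X
  rw [← SymmetricMonoidalMonad.unit_map, w, Category.assoc, ← Functor.map_comp]
  exact .map e (hf.sym_comp hh)

/-- A normal arrow into `T T A` strips twice; `μ` merges the two rounds by `Strip.kleisli`. -/
theorem Normal.comp_mult {A X : LcS P} {f : X ⟶ (monad P).obj ((monad P).obj A)}
    (hf : Normal f) : Normal (f ≫ (monad P).mult A) := by
  cases hf with
  | map d hg =>
  cases hg with
  | map e hg =>
  obtain ⟨d', h, hh, w⟩ := d.kleisli e
  rw [Category.assoc, Functor.map_comp, Category.assoc, ← SymmetricMonoidalMonad.mult_map,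
    reassoc_of% w, ← Functor.map_comp]
  exact .map d' (hg.sym_comp hh)

/-- `ψL` is `dbl` with a unit inserted on the right. That unit is itself a stripping, and it
combines with the one producing `T A` into a single stripping of the tensor product. -/
theorem Normal.comp_ψL {A B X : LcS P} {f : X ⟶ (monad P).obj A ⊗ B} (hf : Normal f) :
    Normal (f ≫ (monad P).ψL A B) := by
  cases hf with
  | @tensor _ _ _ d _ g hf hg =>
  cases hf with
  | @map _ _ e f hf =>
  obtain ⟨e', h, hh, w⟩ := exists_strip_unit d.right
  have w₁ : (d.hom ≫ ((e.hom ≫ (monad P).map f) ⊗ₘ g)) ≫ (monad P).ψL A B =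
      d.hom ≫ ((e.hom ⊗ₘ e'.hom) ≫ (monad P).dbl _ _) ≫
        (monad P).map ((𝟙 _ ⊗ₘ h) ≫ (f ⊗ₘ g)) := by
    have w₂ := (monad P).tensorHom_comp_dbl (x := e.hom) (x' := e.hom) (f := 𝟙 _) (f' := 𝟙 _)
      (by simp) ((Category.id_comp _).trans w)
    rw [id_tensorHom_id, Category.id_comp, ← SymmetricMonoidalMonad.ψL_eq_dbl] at w₂
    have w₃ : (e.hom ≫ (monad P).map f) ⊗ₘ g = (e.hom ⊗ₘ 𝟙 _) ≫ ((monad P).map f ⊗ₘ g) := by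
      rw [tensorHom_comp_tensorHom, Category.id_comp]
    rw [w₃, Category.assoc, Category.assoc, SymmetricMonoidalMonad.ψL_natural,
      reassoc_of% w₂, Functor.map_comp]
    simp only [Category.assoc]
  have := Normal.map (e.tensor e') ((hf.tensorHom hg).sym_comp ((Sym.id _).tensor hh))
  exact w₁ ▸ this.sym_comp d.sym_hom

theorem Normal.comp_ψR {A B X : LcS P} {f : X ⟶ A ⊗ (monad P).obj B} (hf : Normal f) :
    Normal (f ≫ (monad P).ψR A B) := by
  have := hf.comp_c.comp_ψL.comp_map (g := (β_ B A).hom) (fun h => h.comp_c)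
  rwa [Category.assoc, Category.assoc, (monad P).ψLψR_c, SymmetricCategory.symmetry_assoc] at this

theorem Normal.comp_mk {B C : LcS P} (t : Term B C) {A : LcS P} {f : A ⟶ B} (hf : Normal f) :
    Normal (f ≫ mk t) := by
  induction t generalizing A with
  | id A => exact (Category.comp_id f).symm ▸ hf
  | comp s t hs ht => exact (Category.assoc f (mk s) (mk t)) ▸ ht (hs hf)
  | @tensor A₁ A₁' B₁ B₁' s t hs ht =>
    cases hf with
    | @tensor _ _ _ d f g h₁ h₂ =>
    have e : (d.hom ≫ (f ⊗ₘ g)) ≫ (mk s ⊗ₘ mk t) = d.hom ≫ ((f ≫ mk s) ⊗ₘ (g ≫ mk t)) := by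
      rw [Category.assoc, tensorHom_comp_tensorHom]
    exact e ▸ Normal.tensor d (hs h₁) (ht h₂)
  | map s hs => exact hf.comp_map (g := mk s) hs
  | a A B C => exact hf.comp_a
  | aInv A B C => exact hf.comp_aInv
  | l A => exact hf.comp_l
  | lInv A => exact hf.comp_lInv
  | r A => exact hf.comp_r
  | rInv A => exact hf.comp_rInv
  | c A B => exact hf.comp_c
  | ψL A B => exact hf.comp_ψL
  | ψR A B => exact hf.comp_ψR
  | η A => exact hf.comp_unit
  | μ A => exact hf.comp_mult

theorem normal {A B : LcS P} (f : A ⟶ B) : Normal f := by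
  obtain ⟨t, rfl⟩ := Quotient.exists_rep f
  have := (normal_id A).comp_mk t
  rwa [Category.id_comp] at this

/-! ### Arrows acting on occurrences, independently of the numbering. -/

/-- The occurrences of letters and of `T` in a formula. -/
def Node : LcS P → Type
  | letter _ => Unit
  | I => Empty
  | tensor A B => Node A ⊕ Node B
  | T A => Option (Node A)

/-- The action of an arrow term on occurrences. -/
def nodeMap : ∀ {A B : LcS P}, Term A B → Node A → Node B
  | _, _, .id _ => fun x => x
  | _, _, .comp f g => fun x => nodeMap g (nodeMap f x)
  | _, _, .tensor f g => Sum.map (nodeMap f) (nodeMap g)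
  | _, _, .map f => Option.map (nodeMap f)
  | _, _, .a _ _ _ => Equiv.sumAssoc _ _ _
  | _, _, .aInv _ _ _ => (Equiv.sumAssoc _ _ _).symm
  | _, _, .l _ => Sum.elim Empty.elim fun x => x
  | _, _, .lInv _ => Sum.inr
  | _, _, .r _ => Sum.elim (fun x => x) Empty.elim
  | _, _, .rInv _ => Sum.inl
  | _, _, .c _ _ => Sum.swap
  | _, _, .ψL _ _ => Sum.elim (Option.map Sum.inl) (fun y => some (Sum.inr y))
  | _, _, .ψR _ _ => Sum.elim (fun x => some (Sum.inl x)) (Option.map Sum.inr)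
  | _, _, .η _ => some
  | _, _, .μ _ => fun x => Option.elim x none fun y => y

/-- The number of an occurrence, counted from right to left. -/
def pos : ∀ {A : LcS P}, Node A → ℕ
  | letter _, _ => 0
  | tensor _ B, Sum.inl x => size B + pos x
  | tensor _ _, Sum.inr y => pos y
  | T A, none => size A
  | T _, some x => pos x

theorem pos_lt : ∀ {A : LcS P} (x : Node A), pos x < size A
  | letter _, _ => Nat.one_pos
  | tensor _ _, Sum.inl x => Nat.add_lt_add_left (pos_lt x) _
  | tensor _ _, Sum.inr y => Nat.lt_add_right _ (pos_lt y)
  | T _, none => Nat.lt_succ_self _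
  | T _, some x => Nat.lt_succ_of_lt (pos_lt x)

theorem pos_injective : ∀ {A : LcS P} {x y : Node A}, pos x = pos y → x = y
  | letter _, _, _, _ => rfl
  | tensor _ _, Sum.inl _, Sum.inl _, h => congrArg Sum.inl (pos_injective (Nat.add_left_cancel h))
  | tensor _ _, Sum.inr _, Sum.inr _, h => congrArg Sum.inr (pos_injective h)
  | tensor _ B, Sum.inl x, Sum.inr y, h => by
    have := pos_lt y
    simp only [pos] at h
    omega
  | tensor _ B, Sum.inr x, Sum.inl y, h => by
    have := pos_lt x
    simp only [pos] at h
    omega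
  | T _, none, none, _ => rfl
  | T _, some _, some _, h => congrArg some (pos_injective h)
  | T _, none, some x, h => absurd h (pos_lt x).ne'
  | T _, some x, none, h => absurd h (pos_lt x).ne

/-- Ties the structural description of the action to the numerical one defining `G`; with
injectivity of `pos`, equal numerical actions give equal actions on occurrences. -/
theorem pos_nodeMap {A B : LcS P} (f : Term A B) (x : Node A) :
    pos (nodeMap f x) = nmap f (pos x) := by
  induction f with
  | id A => rfl
  | comp f g hf hg => exact (hg _).trans (congrArg _ (hf x))
  | tensor f g hf hg =>
    rcases x with x | x
    · simp [nodeMap, nmap, pos, Sum.map, hf]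
    · simp [nodeMap, nmap, pos, Sum.map, hg, pos_lt]
  | map f hf =>
    rcases x with _ | x
    · simp [nodeMap, nmap, pos]
    · simp [nodeMap, nmap, pos, hf, (pos_lt x).ne]
  | a A B C => rcases x with (x | x) | x; exacts [Nat.add_assoc .., rfl, rfl]
  | aInv A B C => rcases x with x | x | x; exacts [(Nat.add_assoc ..).symm, rfl, rfl]
  | l A => rcases x with x | x; exacts [x.elim, rfl]
  | lInv A => rfl
  | r A => rcases x with x | x; exacts [(Nat.zero_add _).symm, x.elim]
  | rInv A => exact Nat.zero_add _
  | c A B =>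
    rcases x with x | x
    · simp [nodeMap, nmap, pos]
    · simp [nodeMap, nmap, pos, pos_lt]
  | ψL A B => rcases x with (_ | x) | x <;> rfl
  | ψR A B =>
    rcases x with x | _ | x
    · change size B + pos x = nmap (Term.ψR A B) (size B + 1 + pos x)
      grind [nmap]
    · change size B + size A = nmap (Term.ψR A B) (size B)
      grind [nmap]
    · have := pos_lt x
      change pos x = nmap (Term.ψR A B) (pos x)
      grind [nmap]
  | η A => rfl
  | μ A =>
    rcases x with _ | _ | x
    · change size A = nmap (Term.μ A) (size A + 1)
      grind [nmap]
    · change size A = nmap (Term.μ A) (size A)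
      grind [nmap]
    · have := pos_lt x
      change pos x = nmap (Term.μ A) (pos x)
      grind [nmap]

theorem nodeMap_eq {A B : LcS P} {f g : Term A B} (h : ∀ n < size A, nmap f n = nmap g n) :
    nodeMap f = nodeMap g :=
  funext fun x => pos_injective <| by rw [pos_nodeMap, pos_nodeMap, h _ (pos_lt x)]

/-- The action of an arrow on occurrences. -/
def trace {A B : LcS P} : (A ⟶ B) → Node A → Node B :=
  Quotient.lift nodeMap fun _ _ h => nodeMap_eq (nmap_eq h)

theorem trace_eq_of_G_map_eq {A B : LcS P} {f g : A ⟶ B} (h : (G P).map f = (G P).map g) :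
    trace f = trace g := by
  induction f using Quotient.inductionOn with | _ s
  induction g using Quotient.inductionOn with | _ t
  refine nodeMap_eq fun n hn => ?_
  have := congrArg ULift.down (congrFun h ⟨⟨n, hn⟩⟩)
  exact (gmap_val s ⟨n, hn⟩).symm.trans ((congrArg Fin.val this).trans (gmap_val t ⟨n, hn⟩))

theorem trace_comp {A B C : LcS P} (f : A ⟶ B) (g : B ⟶ C) (x : Node A) :
    trace (f ≫ g) x = trace g (trace f x) := by
  induction f using Quotient.inductionOn
  induction g using Quotient.inductionOn
  rfl

theorem trace_tensor {A A' B B' : LcS P} (f : A ⟶ A') (g : B ⟶ B') :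
    trace (f ⊗ₘ g) = Sum.map (trace f) (trace g) := by
  induction f using Quotient.inductionOn
  induction g using Quotient.inductionOn
  rfl

theorem trace_map {A B : LcS P} (f : A ⟶ B) :
    trace ((monad P).map f) = Option.map (trace f) := by
  induction f using Quotient.inductionOn
  rfl

theorem trace_surjective {A B : LcS P} (f : A ⟶ B) [IsIso f] :
    Function.Surjective (trace f) := fun y =>
  ⟨trace (inv f) y, by rw [← trace_comp, IsIso.inv_hom_id]; rfl⟩

/-! ### Recovering distributions and strippings from traces. -/

/-- The occurrences that a distribution sends to the left-hand side. -/
def Split.side : ∀ {A : LcS P}, Split A → Node A → Bool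
  | _, letterL _ => fun _ => true
  | _, letterR _ => fun _ => false
  -- The value is immaterial, since `I` has no occurrences.
  | _, I => fun _ => true
  | _, tensor d e => Sum.elim d.side e.side
  | _, TL _ => fun _ => true
  | _, TR _ => fun _ => false

theorem Split.isLeft_trace {A : LcS P} (d : Split A) (x : Node A) :
    Sum.isLeft (α := Node d.left) (β := Node d.right) (trace d.hom x) = d.side x := by
  induction d with
  | letterL p => rfl
  | letterR p => rfl
  | I => exact x.elim
  | TL A => rfl
  | TR A => rfl
  | tensor d e hd he =>
    rcases x with x | x
    · have h : trace (d.tensor e).hom (Sum.inl x) = trace (tensorμ d.left d.right e.left e.right)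
          (Sum.inl (trace d.hom x)) :=
        (trace_comp (d.hom ⊗ₘ e.hom) (tensorμ _ _ _ _) (Sum.inl x)).trans
          (by rw [trace_tensor]; rfl)
      rw [h]
      refine Eq.trans ?_ (hd x)
      rcases (trace d.hom x : Node d.left ⊕ Node d.right) with y | y <;> rfl
    · have h : trace (d.tensor e).hom (Sum.inr x) = trace (tensorμ d.left d.right e.left e.right)
          (Sum.inr (trace e.hom x)) :=
        (trace_comp (d.hom ⊗ₘ e.hom) (tensorμ _ _ _ _) (Sum.inr x)).trans
          (by rw [trace_tensor]; rfl)
      rw [h]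
      refine Eq.trans ?_ (he x)
      rcases (trace e.hom x : Node e.left ⊕ Node e.right) with y | y <;> rfl

theorem Split.side_injective {A : LcS P} {d e : Split A} (h : d.side = e.side) : d = e := by
  induction d with
  | letterL p => cases e with
    | letterL => rfl
    | letterR => exact absurd (congrFun h ()) Bool.noConfusion
  | letterR p => cases e with
    | letterL => exact absurd (congrFun h ()) Bool.noConfusion
    | letterR => rfl
  | I => cases e; rfl
  | TL A => cases e with
    | TL => rfl
    | TR => exact absurd (congrFun h none) Bool.noConfusion
  | TR A => cases e with
    | TL => exact absurd (congrFun h none) Bool.noConfusion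
    | TR => rfl
  | tensor d d' hd hd' =>
    cases e with
    | tensor e e' =>
    rw [hd (funext fun x => congrFun h (Sum.inl x)), hd' (funext fun x => congrFun h (Sum.inr x))]

/-- The occurrences that remain after deletion. -/
def Strip.kept : ∀ {A : LcS P}, Strip A → Node A → Bool
  | _, letter _ => fun _ => true
  | _, I => fun _ => true
  | _, tensor d e => Sum.elim d.kept e.kept
  | _, keep _ => fun _ => true
  | _, strip d => fun x => Option.elim x false d.kept

theorem Strip.trace_tensor_hom_inl {A B : LcS P} (d : Strip A) (e : Strip B) (x : Node A) :
    trace (d.tensor e).hom (Sum.inl x) =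
      Option.map (α := Node d.res) (Sum.inl (β := Node e.res)) (trace d.hom x) := by
  have h : trace (d.tensor e).hom (Sum.inl x) = trace ((monad P).dbl d.res e.res)
      (Sum.inl (trace d.hom x)) :=
    (trace_comp (d.hom ⊗ₘ e.hom) ((monad P).dbl d.res e.res) (Sum.inl x)).trans
      (by rw [trace_tensor]; rfl)
  rw [h]
  rcases (trace d.hom x : Option (Node d.res)) with _ | y <;> rfl

theorem Strip.trace_tensor_hom_inr {A B : LcS P} (d : Strip A) (e : Strip B) (x : Node B) :
    trace (d.tensor e).hom (Sum.inr x) =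
      Option.map (α := Node e.res) (Sum.inr (α := Node d.res)) (trace e.hom x) := by
  have h : trace (d.tensor e).hom (Sum.inr x) = trace ((monad P).dbl d.res e.res)
      (Sum.inr (trace e.hom x)) :=
    (trace_comp (d.hom ⊗ₘ e.hom) ((monad P).dbl d.res e.res) (Sum.inr x)).trans
      (by rw [trace_tensor]; rfl)
  rw [h]
  rcases (trace e.hom x : Option (Node e.res)) with _ | y <;> rfl

theorem Strip.trace_strip_hom_some {A : LcS P} (d : Strip A) (x : Node A) :
    trace d.strip.hom (some x) = trace d.hom x :=
  (trace_comp ((monad P).map d.hom) ((monad P).mult d.res) (some x)).trans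
    (by
      rw [trace_map]
      change trace ((monad P).mult d.res) (some (trace d.hom x)) = _
      rcases (trace d.hom x : Option (Node d.res)) with _ | y <;> rfl)

theorem Strip.trace_strip_hom_none {A : LcS P} (d : Strip A) :
    trace d.strip.hom none = none :=
  (trace_comp ((monad P).map d.hom) ((monad P).mult d.res) none).trans
    (by rw [trace_map]; rfl)

theorem Strip.isSome_trace {A : LcS P} (d : Strip A) (x : Node A) :
    Option.isSome (α := Node d.res) (trace d.hom x) = d.kept x := by
  induction d with
  | letter p => rfl
  | I => exact x.elim
  | keep A => rfl
  | strip d hd =>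
    rcases x with _ | x
    · rw [trace_strip_hom_none]; rfl
    · rw [trace_strip_hom_some]; exact hd x
  | tensor d e hd he =>
    rcases x with x | x
    · rw [trace_tensor_hom_inl]
      exact (Option.isSome_map ..).trans (hd x)
    · rw [trace_tensor_hom_inr]
      exact (Option.isSome_map ..).trans (he x)

/-- `keep` and `strip` differ on the outermost `T`, which is the occurrence `none`. -/
theorem Strip.kept_injective {A : LcS P} {d e : Strip A} (h : d.kept = e.kept) : d = e := by
  induction d with
  | letter p => cases e; rfl
  | I => cases e; rfl
  | keep A => cases e with
    | keep => rfl
    | strip => exact absurd (congrFun h none) Bool.noConfusion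
  | strip d hd => cases e with
    | keep => exact absurd (congrFun h none) Bool.noConfusion
    | strip e => rw [hd (funext fun x => congrFun h (some x))]
  | tensor d d' hd hd' =>
    cases e with
    | tensor e e' =>
    rw [hd (funext fun x => congrFun h (Sum.inl x)), hd' (funext fun x => congrFun h (Sum.inr x))]

/-- Stands in for surjectivity, which can fail: when no `T` is stripped, nothing reaches the new
outer `T`. -/
theorem Strip.exists_trace_eq_some {A : LcS P} (d : Strip A) (y : Node d.res) :
    ∃ x, trace d.hom x = some y := by
  induction d with
  | letter p => exact ⟨y, rfl⟩
  | I => exact y.elim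
  | keep A => exact ⟨y, rfl⟩
  | strip d hd =>
    obtain ⟨x, hx⟩ := hd y
    exact ⟨some x, (d.trace_strip_hom_some x).trans hx⟩
  | tensor d e hd he =>
    rcases y with y | y
    · obtain ⟨x, hx⟩ := hd y
      exact ⟨Sum.inl x, by rw [trace_tensor_hom_inl, hx]; rfl⟩
    · obtain ⟨x, hx⟩ := he y
      exact ⟨Sum.inr x, by rw [trace_tensor_hom_inr, hx]; rfl⟩

/-! ### Uniqueness of normal forms. -/

theorem Null.eq {A : LcS P} {f g : A ⟶ 𝟙_ (LcS P)} (hf : Null f) (hg : Null g) : f = g := by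
  induction hf with
  | I => cases hg; rfl
  | tensor _ _ h₁ h₂ =>
    cases hg with
    | tensor h₁' h₂' => rw [h₁ h₁', h₂ h₂']

theorem isEmpty_node {A : LcS P} (f : A ⟶ 𝟙_ (LcS P)) : IsEmpty (Node A) :=
  ⟨fun x => (trace f x : Empty).elim⟩

theorem Single.node {p : P} {A : LcS P} {f : A ⟶ letter p} (hf : Single p f) :
    Nonempty (Node A) := by
  have := hf.sym.isIso
  exact ⟨trace (inv f) ()⟩

theorem Single.eq {p : P} {A : LcS P} {f g : A ⟶ letter p} (hf : Single p f)
    (hg : Single p g) : f = g := by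
  induction hf with
  | id => cases hg; rfl
  | left hs hn ih =>
    cases hg with
    | left hs' hn' => rw [ih hs', hn.eq hn']
    -- The left factor contains the letter, whereas an arrow from it to `I` would leave it without
    -- occurrences.
    | @right _ _ n => exact (not_isEmpty_iff.2 hs.node (isEmpty_node n)).elim
  | right hn hs ih =>
    cases hg with
    | @left _ _ _ n => exact (not_isEmpty_iff.2 hs.node (isEmpty_node n)).elim
    | right hn' hs' => rw [ih hs', hn.eq hn']

/-- The target fixes the last constructor of both normal forms, so only the chosen `Split` or
`Strip` and the components have to be compared. -/
theorem Normal.eq {A B : LcS P} {f g : A ⟶ B} (hf : Normal f) (hg : Normal g)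
    (h : trace f = trace g) : f = g := by
  induction hf with
  | null hf => cases hg with
    | null hg => exact hf.eq hg
  | single hf => cases hg with
    | single hg => exact hf.eq hg
  | @tensor A B₁ B₂ d f₁ f₂ _ _ ih₁ ih₂ =>
    cases hg with
    | @tensor _ _ _ e g₁ g₂ h₁ h₂ =>
    have isLeft_map : ∀ (d : Split A) (f : d.left ⟶ B₁) (g : d.right ⟶ B₂) (x : Node A),
        Sum.isLeft (α := Node B₁) (β := Node B₂) (trace (d.hom ≫ (f ⊗ₘ g)) x) = d.side x := by
      intro d f g x
      rw [trace_comp, trace_tensor]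
      exact (Sum.isLeft_map ..).trans (d.isLeft_trace x)
    -- The components respect the two sides, so the common trace shows where each occurrence was
    -- distributed.
    obtain rfl : d = e := Split.side_injective <| funext fun x => by
      rw [← isLeft_map d f₁ f₂, h, isLeft_map]
    have := d.sym_hom.isIso
    have key : Sum.map (trace f₁) (trace f₂) = Sum.map (trace g₁) (trace g₂) := by
      funext y
      obtain ⟨x, rfl⟩ := trace_surjective d.hom y
      have := congrFun h x
      rwa [trace_comp, trace_comp, trace_tensor, trace_tensor] at this
    rw [ih₁ h₁ (funext fun y => Sum.inl_injective (congrFun key (Sum.inl y))),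
      ih₂ h₂ (funext fun y => Sum.inr_injective (congrFun key (Sum.inr y)))]
  | @map A B d f _ ih =>
    cases hg with
    | @map _ _ e g hg =>
    have isSome_map : ∀ (d : Strip A) (f : d.res ⟶ B) (x : Node A),
        Option.isSome (α := Node B) (trace (d.hom ≫ (monad P).map f) x) = d.kept x := by
      intro d f x
      rw [trace_comp, trace_map]
      exact (Option.isSome_map ..).trans (d.isSome_trace x)
    -- Mapping under `T` never moves an occurrence into or out of the outer `T`, so the common trace
    -- shows which occurrences were stripped.
    obtain rfl : d = e := Strip.kept_injective <| funext fun x => by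
      rw [← isSome_map d f, h, isSome_map]
    refine congrArg (fun k => d.hom ≫ (monad P).map k) (ih hg (funext fun y => ?_))
    obtain ⟨x, hx⟩ := d.exists_trace_eq_some y
    have := congrFun h x
    rw [trace_comp, trace_comp, trace_map, trace_map, hx] at this
    exact Option.some_injective _ this

end LcS

theorem mainTheorem3 (P : Type u) : (LcS.G P).Faithful :=
  ⟨fun h => (LcS.normal _).eq (LcS.normal _) (LcS.trace_eq_of_G_map_eq h)⟩
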